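/- Let $\mathbf k$ be a field of characteristic zero and $d\ge 0$ an integer. Let $\mathbf D=\mathbf k[[\hbar]][[x^1,\dots,x^d]][[\hbar\partial_1,\dots,\hbar\partial_d]]$ be the completed algebra of $\hbar$-differential operators with its standard product (so $[\hbar\partial_i,x^j]=\hbar\delta_{ij}$, and $\hbar$ is central), graded by $\deg\hbar=2$, $\deg x^i=\deg\hbar\partial_i=1$, and let $\mathbf I\subset\mathbf D$ be the closed two-sided ideal spanned by the elements of degree $\ge 2$. For a formal expression $\psi=\exp\big(S_0/\hbar+\sum_{g\ge1}\hbar^{g-1}S_g\big)$ with $S_g=\sum_{n\ge0}S_{g,n}\in\mathbf k[[x^1,\dots,x^d]]$, where $S_{g,n}$ is homogeneous of degree $n$ and $S_{0,1}=0$, let $T_\psi$ (informally $f\mapsto\psi^{-1}f\psi$) be the continuous automorphism of $\mathbf D$ with $T_\psi(\hbar)=\hbar$, $T_\psi(x^i)=x^i$, $T_\psi(\hbar\partial_i)=\hbar\partial_i+\partial_i\big(S_0+\sum_{g\ge1}\hbar^gS_g\big)$. One says that $\widehat H(\psi)=0$, for $\widehat H\in\mathbf D$, if $T_\psi(\widehat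 H)(1)=0$. (a) Let $\widehat H_1,\dots,\widehat H_d\in\mathbf D$ be such that $\widehat H_i=-\hbar\partial_i+P_i$ with $P_i\in\mathbf I$, and such that for all $i\ne j$ there are $g_{ij}^k\in\mathbf D$ with $\frac1\hbar[\widehat H_i,\widehat H_j]=\sum_k g_{ij}^k\widehat H_k$. Then there is a unique $\psi=\exp\big(S_0/\hbar+\sum_{g\ge1}\hbar^{g-1}S_g\big)$ with $S_{0,n}=0$ for $n\le2$ and $S_{g,0}=0$ for all $g\ge 0$ such that $\widehat H_i(\psi)=0$ for all $i$. (b) Let $(A,B,C,\varepsilon)=(a_{ijk},b_{ij}^k,c_i^{jk},\varepsilon_i)$ be a quantum Airy structure on $\mathbf k^d$: tensors over $\mathbf k$ with $a_{ijk}=a_{ikj}$ and $c_i^{jk}=c_i^{kj}$ such that the $\mathbf k$-span of the operators $$\widehat H_i=-\hbar\partial_i+\sum_{j,k}a_{ijk}x^jx^k+2\sum_{j,k}b_{ij}^kx^j\hbar\partial_k+\sum_{j,k}c_i^{jk}\hbar\partial_j\hbar\partial_k+\hbar\varepsilon_i$$ is closed under the bracket $\frac1\hbar[\cdot,\cdot]$.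 Then the system $\widehat H_i(\psi)=0$, $1\le i\le d$, has a unique solution $\psi$ normalized as in (a). Let $S_{g,n;i_1,\dots,i_n}=\partial_{i_1}\cdots\partial_{i_n}S_g(0)$. These tensors are symmetric in $i_1,\dots,i_n$. For every choice of the order in which the elements of the finite sets $J\subset\{1,\dots,n-1\}$ are enumerated when forming the sequences $i_J=(i_\alpha)_{\alpha\in J}$, they are the unique family of tensors with $S_{0,n}=0$ for $n\le 2$, $S_{g,0}=0$ for all $g$, $S_{0,3}=2A$, $S_{1,1}=\varepsilon$ that satisfies, in the cases $g=0,n\ge4$, or $g=1,n\ge2$, or $g\ge2,n\ge1$, the abstract topological recursion $$S_{g,n;i,i_1,\dots,i_{n-1}}=2\sum_{\alpha=1}^{n-1}\sum_k b_{ii_\alpha}^kS_{g,n-1;k,i_{\{1,\dots,n-1\}\setminus\{\alpha\}}}+\sum_{\substack{g_1+g_2=g\\J_1\sqcup J_2=\{1,\dots,n-1\}}}\sum_{j,k}c_i^{jk}S_{g_1,\#J_1+1;j,i_{J_1}}S_{g_2,\#J_2+1;k,i_{J_2}}+\sum_{j,k}c_i^{jk}S_{g-1,n+1;j,k,i_1,\dots,i_{n-1}},$$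 where the last sum is absent for $g=0$. -/

import Mathlib

namespace HbarDiff

/-! ### Formal functions -/

/-- The ring `k[[ħ]][[x₁, …, x_d]]` of formal functions depending on the formal parameter `ħ`. The
variable `none` is `ħ`, the variable `some i` is `x_i`. -/
abbrev Fun (k : Type*) (d : ℕ) : Type _ := MvPowerSeries (Option (Fin d)) k

/-- The grading `deg ħ = 2`, `deg x_i = 1` on monomials in `ħ` and `x`. -/
noncomputable def funDeg {d : ℕ} : (Option (Fin d) →₀ ℕ) →+ ℕ :=
  Finsupp.weight (fun o : Option (Fin d) => o.elim 2 (fun _ => 1))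

/-- The formal parameter `ħ`, as a formal function. -/
noncomputable abbrev hbarF (k : Type*) [CommSemiring k] (d : ℕ) : Fun k d :=
  MvPowerSeries.X none

/-- The operator `ħ ∂/∂x_i` on formal functions. -/
noncomputable def hpd {k : Type*} [CommRing k] {d : ℕ} (i : Fin d) : AddMonoid.End (Fun k d) :=
  (AddMonoidHom.mulLeft (hbarF k d)).comp
    (MvPowerSeries.pderiv k (some i) : Derivation k (Fun k d) (Fun k d)).toLinearMap.toAddMonoidHom

/-- The series all of whose monomials `ħ^c x^m` have degree `2c + |m| ≥ w`. -/
def funGE {k : Type*} [CommRing k] {d : ℕ} (w : ℕ) : AddSubgroup (Fun k d) where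
  carrier := {f | ∀ e, funDeg e < w → MvPowerSeries.coeff e f = 0}
  zero_mem' := by intro e _; simp
  add_mem' := by intro a b ha hb e he; simp [ha e he, hb e he]
  neg_mem' := by intro a ha e he; simp [ha e he]

/-- A coefficientwise (finite) sum of a family of series indexed by the exponents `β`. -/
noncomputable def funSum {k : Type*} [CommRing k] {d : ℕ} (u : (Fin d →₀ ℕ) → Fun k d) : Fun k d :=
  fun e => ∑ᶠ β, MvPowerSeries.coeff e (u β)

/-! ### The completed algebra of `ħ`-differential operators -/

/-- The underlying space of `D = k[[ħ]][[x]][[ħ∂]]`: a family `(f_γ)` of formal functions stands for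
the normally ordered operator `∑_γ f_γ (ħ∂)^γ`. -/
def DOp (k : Type*) (d : ℕ) : Type _ := MvPowerSeries (Fin d) (Fun k d)

namespace DOp

variable {k : Type*} [CommRing k] {d : ℕ}

noncomputable instance : AddCommGroup (DOp k d) :=
  inferInstanceAs (AddCommGroup (MvPowerSeries (Fin d) (Fun k d)))

/-- Multiplication of an operator by a formal function from the left. -/
noncomputable instance : Module (Fun k d) (DOp k d) :=
  inferInstanceAs (Module (Fun k d) (MvPowerSeries (Fin d) (Fun k d)))

/-- The coefficient `f_γ` of an operator `f = ∑_γ f_γ (ħ∂)^γ`. -/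
noncomputable def coeff (γ : Fin d →₀ ℕ) : DOp k d →ₗ[Fun k d] Fun k d :=
  MvPowerSeries.coeff (R := Fun k d) γ

@[ext] theorem ext {f g : DOp k d} (h : ∀ γ, coeff γ f = coeff γ g) : f = g :=
  MvPowerSeries.ext h

/-- The operator `∑_γ f_γ (ħ∂)^γ` with prescribed coefficients. -/
def mk (f : (Fin d →₀ ℕ) → Fun k d) : DOp k d := f

@[simp] theorem coeff_mk (f : (Fin d →₀ ℕ) → Fun k d) (γ) : coeff γ (mk f) = f γ := rfl

/-- The operator of multiplication by a formal function. -/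
noncomputable def ofFun (a : Fun k d) : DOp k d := MvPowerSeries.C (R := Fun k d) a

/-- The operator `ħ ∂_i`. -/
noncomputable def p (i : Fin d) : DOp k d := MvPowerSeries.X (R := Fun k d) i

/-- Normally ordered multiplication by the symbol `ħ∂_i`: it maps `∑_γ f_γ (ħ∂)^γ` to
`∑_γ f_γ (ħ∂)^{γ + e_i}`. -/
noncomputable def shift (i : Fin d) : DOp k d →+ DOp k d :=
  AddMonoidHom.mulLeft (MvPowerSeries.X (R := Fun k d) i : MvPowerSeries (Fin d) (Fun k d))

/-- The map `∑_γ f_γ (ħ∂)^γ ↦ ∑_γ (ħ ∂f_γ/∂x_i) (ħ∂)^γ`. -/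
noncomputable def hpdCoeff (i : Fin d) : DOp k d →+ DOp k d where
  toFun f := mk fun γ => hpd i (coeff γ f)
  map_zero' := by ext1 γ; simp
  map_add' f g := by ext1 γ; simp

/-- Composition with `ħ∂_i` from the left, in normally ordered form: by the Leibniz rule
`ħ∂_i ∘ (f_γ (ħ∂)^γ) = f_γ (ħ∂)^{γ + e_i} + (ħ ∂f_γ/∂x_i) (ħ∂)^γ`. -/
noncomputable def nabla (i : Fin d) : AddMonoid.End (DOp k d) := shift i + hpdCoeff i

/-- Composition with `(ħ∂)^β` from the left. -/
noncomputable def nablaPow (β : Fin d →₀ ℕ) : AddMonoid.End (DOp k d) :=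
  (List.ofFn fun i => nabla i ^ β i).prod

/-- A coefficientwise (finite) sum of a family of operators indexed by the exponents `β`. -/
noncomputable def opSum (u : (Fin d →₀ ℕ) → DOp k d) : DOp k d :=
  mk fun γ => funSum fun β => coeff γ (u β)

/-- The standard product of differential operators:
`(∑_β f_β (ħ∂)^β) ∘ g = ∑_β f_β · ((ħ∂)^β ∘ g)`. -/
noncomputable instance : Mul (DOp k d) := ⟨fun f g => opSum fun β => coeff β f • nablaPow β g⟩

noncomputable instance : One (DOp k d) := ⟨ofFun 1⟩

theorem mul_def (f g : DOp k d) : f * g = opSum fun β => coeff β f • nablaPow β g := rfl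

theorem one_def : (1 : DOp k d) = ofFun 1 := rfl

/-- The operators all of whose monomials `ħ^c x^m (ħ∂)^γ` have degree `2c + |m| + |γ| ≥ w`, for the
grading `deg ħ = 2`, `deg x_i = deg ħ∂_i = 1`. For `w = 2` it is the ideal `I`. -/
def degGE (w : ℕ) : AddSubgroup (DOp k d) where
  carrier := {f | ∀ γ e, γ.degree + funDeg e < w → MvPowerSeries.coeff e (coeff γ f) = 0}
  zero_mem' := by intro γ e _; simp
  add_mem' := by intro a b ha hb γ e he; simp [ha γ e he, hb γ e he]
  neg_mem' := by intro a ha γ e he; simp [ha γ e he]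

/-! #### `D` is an associative ring -/

theorem coeff_shift (i : Fin d) (f : DOp k d) (γ : Fin d →₀ ℕ) :
    coeff γ (shift i f) = if γ i = 0 then 0 else coeff (γ - Finsupp.single i 1) f := by
  classical
  have key : ∀ g : MvPowerSeries (Fin d) (Fun k d),
      MvPowerSeries.coeff γ (MvPowerSeries.X i * g) =
        if γ i = 0 then 0 else MvPowerSeries.coeff (γ - Finsupp.single i 1) g := by
    intro g
    rw [MvPowerSeries.X_def, MvPowerSeries.coeff_monomial_mul]
    by_cases h : γ i = 0
    · simp [h]
    · have : 1 ≤ γ i := Nat.one_le_iff_ne_zero.mpr h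
      simp [h, this]
  exact key f

theorem coeff_hpdCoeff (i : Fin d) (f : DOp k d) (γ : Fin d →₀ ℕ) :
    coeff γ (hpdCoeff i f) = hpd i (coeff γ f) := rfl

theorem hpd_apply (i : Fin d) (a : Fun k d) :
    hpd i a = hbarF k d * MvPowerSeries.pderiv k (some i) a := rfl

theorem hpd_mul (i : Fin d) (a b : Fun k d) : hpd i (a * b) = hpd i a * b + a * hpd i b := by
  simp [hpd_apply]; ring

theorem hpd_comm (i j : Fin d) (a : Fun k d) : hpd i (hpd j a) = hpd j (hpd i a) := by
  have h : MvPowerSeries.pderiv k (some i) (MvPowerSeries.pderiv k (some j) a) =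
      MvPowerSeries.pderiv k (some j) (MvPowerSeries.pderiv k (some i) a) := by
    ext n
    simp only [MvPowerSeries.coeff_pderiv]
    by_cases hij : i = j
    · subst hij; rfl
    · have hji : j ≠ i := fun h => hij h.symm
      simp only [Finsupp.add_apply, ne_eq, Option.some.injEq, hij, hji, not_false_eq_true,
        Finsupp.single_eq_of_ne, add_zero, add_right_comm n]
      ring
  simp [hpd_apply, h]

theorem shift_comm (i j : Fin d) (f : DOp k d) : shift i (shift j f) = shift j (shift i f) :=
  mul_left_comm (MvPowerSeries.X (R := Fun k d) i) (MvPowerSeries.X (R := Fun k d) j)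
    (f : MvPowerSeries (Fin d) (Fun k d))

theorem shift_hpdCoeff (i j : Fin d) (f : DOp k d) :
    shift i (hpdCoeff j f) = hpdCoeff j (shift i f) := by
  ext1 γ
  simp only [coeff_shift, coeff_hpdCoeff]
  split_ifs <;> simp

theorem hpdCoeff_comm (i j : Fin d) (f : DOp k d) :
    hpdCoeff i (hpdCoeff j f) = hpdCoeff j (hpdCoeff i f) := by
  ext1 γ
  simp only [coeff_hpdCoeff, hpd_comm i j]

theorem nabla_apply (i : Fin d) (f : DOp k d) : nabla i f = shift i f + hpdCoeff i f := rfl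

theorem nabla_comm (i j : Fin d) : Commute (nabla (k := k) i) (nabla j) := by
  refine AddMonoidHom.ext fun f => ?_
  change nabla i (nabla j f) = nabla j (nabla i f)
  simp only [nabla_apply, map_add, shift_comm i j, hpdCoeff_comm i j, shift_hpdCoeff]
  abel

theorem list_prod_comm {M : Type*} [Monoid M] {n : ℕ} (a : Fin n → M)
    (h : ∀ i j, Commute (a i) (a j)) (b : Fin n → ℕ) (i : Fin n) :
    a i * (List.ofFn fun j => a j ^ b j).prod =
      (List.ofFn fun j => a j ^ (b j + if i = j then 1 else 0)).prod := by
  induction n with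
  | zero => exact i.elim0
  | succ n ih =>
    simp only [List.ofFn_succ, List.prod_cons]
    refine Fin.cases ?_ (fun i => ?_) i
    · simp [pow_succ', mul_assoc, (Fin.succ_ne_zero _).symm]
    · have := ih (fun j => a j.succ) (fun _ _ => h _ _) (fun j => b j.succ) i
      rw [← mul_assoc, ((h i.succ 0).pow_right _).eq, mul_assoc, this]
      simp [Fin.succ_ne_zero]

theorem nabla_nablaPow (i : Fin d) (β : Fin d →₀ ℕ) (f : DOp k d) :
    nabla i (nablaPow β f) = nablaPow (β + Finsupp.single i 1) f := by
  have h := list_prod_comm (fun j => nabla (k := k) j) nabla_comm β i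
  have h' : nabla i * nablaPow (k := k) β = nablaPow (β + Finsupp.single i 1) := by
    rw [nablaPow, h, nablaPow]
    simp [Finsupp.single_apply]
  exact DFunLike.congr_fun h' f

theorem nablaPow_zero (f : DOp k d) : nablaPow 0 f = f := by
  simp [nablaPow]

/-- Induction on exponents. -/
theorem exp_induction {P : (Fin d →₀ ℕ) → Prop} (h0 : P 0)
    (hs : ∀ β i, P β → P (β + Finsupp.single i 1)) (β : Fin d →₀ ℕ) : P β := by
  obtain ⟨n, hn⟩ : ∃ n, β.degree = n := ⟨_, rfl⟩
  induction n generalizing β with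
  | zero => rw [Finsupp.degree_eq_zero_iff] at hn; exact hn ▸ h0
  | succ n ih =>
    obtain ⟨i, hi⟩ : ∃ i, β i ≠ 0 := by
      by_contra! h
      have : β = 0 := Finsupp.ext h
      simp [this] at hn
    have hle : Finsupp.single i 1 ≤ β := by
      simpa using Nat.one_le_iff_ne_zero.mpr hi
    have e : β - Finsupp.single i 1 + Finsupp.single i 1 = β := tsub_add_cancel_of_le hle
    rw [← e]
    refine hs _ _ (ih _ ?_)
    have := congrArg Finsupp.degree e
    rw [map_add, Finsupp.degree_single] at this
    omega

theorem nablaPow_smul_one_coeff (β γ : Fin d →₀ ℕ) :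
    coeff γ (nablaPow β (1 : DOp k d)) = if γ = β then 1 else 0 := by
  classical
  induction β using exp_induction generalizing γ with
  | h0 =>
    rw [nablaPow_zero]
    change MvPowerSeries.coeff γ (MvPowerSeries.C (1 : Fun k d)) = _
    rw [map_one, MvPowerSeries.coeff_one]
  | hs β i ih =>
    rw [← nabla_nablaPow, nabla_apply, map_add, coeff_shift, coeff_hpdCoeff, ih, ih]
    have h1 : hpd i (if γ = β then (1 : Fun k d) else 0) = 0 := by
      split_ifs <;> simp [hpd_apply]
    rw [h1, add_zero]
    by_cases h : γ i = 0
    · have : γ ≠ β + Finsupp.single i 1 := by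
        rintro rfl; simp at h
      simp [h, this]
    · have hle : Finsupp.single i 1 ≤ γ := by
        simpa using Nat.one_le_iff_ne_zero.mpr h
      simp [h, tsub_eq_iff_eq_add_of_le hle]

/-! Degree estimates and convergence. -/

theorem coeff_smul' (a : Fun k d) (f : DOp k d) (γ) : coeff γ (a • f) = a * coeff γ f := by
  simp

theorem smul_degGE {v w : ℕ} {a : Fun k d} {f : DOp k d} (ha : a ∈ funGE v) (hf : f ∈ degGE w) :
    a • f ∈ degGE (v + w) := by
  classical
  intro γ e he
  rw [coeff_smul', MvPowerSeries.coeff_mul]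
  refine Finset.sum_eq_zero fun x hx => ?_
  rw [Finset.HasAntidiagonal.mem_antidiagonal] at hx
  have hd : funDeg x.1 + funDeg x.2 = funDeg e := by rw [← map_add, hx]
  by_cases h : funDeg x.1 < v
  · rw [ha _ h, zero_mul]
  · rw [hf γ x.2 (by omega), mul_zero]

theorem funGE_zero (a : Fun k d) : a ∈ funGE 0 := by intro e he; omega

theorem degGE_zero (a : DOp k d) : a ∈ degGE 0 := by intro γ e he; omega

theorem degGE_anti {v w : ℕ} (h : v ≤ w) {f : DOp k d} (hf : f ∈ degGE w) : f ∈ degGE v :=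
  fun γ e he => hf γ e (by omega)

theorem smul_degGE' {w : ℕ} (a : Fun k d) {f : DOp k d} (hf : f ∈ degGE w) :
    a • f ∈ degGE w := by
  simpa using smul_degGE (funGE_zero a) hf

theorem hpd_funGE {w : ℕ} (i : Fin d) {a : Fun k d} (ha : a ∈ funGE w) :
    hpd i a ∈ funGE (w + 1) := by
  classical
  intro e he
  change MvPowerSeries.coeff e (MvPowerSeries.X none * MvPowerSeries.pderiv k (some i) a) = 0
  rw [MvPowerSeries.X_def, MvPowerSeries.coeff_monomial_mul]
  split_ifs with h
  · rw [MvPowerSeries.coeff_pderiv, ha, zero_mul, mul_zero]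
    have h1 : funDeg (e - Finsupp.single none 1) + funDeg (d := d) (Finsupp.single none 1) =
        funDeg e := by rw [← map_add, tsub_add_cancel_of_le h]
    have h2 : funDeg (d := d) (Finsupp.single none 1) = 2 := by
      simp [funDeg, Finsupp.weight_single]
    have h3 : funDeg (d := d) (Finsupp.single (some i) 1) = 1 := by
      simp [funDeg, Finsupp.weight_single]
    rw [map_add]
    omega
  · rfl

theorem coeff_mem_funGE {w : ℕ} {f : DOp k d} (hf : f ∈ degGE w) (γ) :
    coeff γ f ∈ funGE (w - γ.degree) := fun e he => hf γ e (by omega)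

theorem nabla_degGE {w : ℕ} (i : Fin d) {f : DOp k d} (hf : f ∈ degGE w) :
    nabla i f ∈ degGE (w + 1) := by
  rw [nabla_apply]
  refine add_mem (fun γ e he => ?_) (fun γ e he => ?_)
  · rw [coeff_shift]
    split_ifs with h
    · simp
    · refine hf _ _ ?_
      have hle : Finsupp.single i 1 ≤ γ := by
        simpa using Nat.one_le_iff_ne_zero.mpr h
      have := congrArg Finsupp.degree (tsub_add_cancel_of_le hle)
      rw [map_add, Finsupp.degree_single] at this
      omega
  · rw [coeff_hpdCoeff]
    refine hpd_funGE i (w := w - γ.degree) (coeff_mem_funGE hf γ) e ?_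
    omega

theorem nablaPow_degGE {w : ℕ} (β) {f : DOp k d} (hf : f ∈ degGE w) :
    nablaPow β f ∈ degGE (w + β.degree) := by
  induction β using exp_induction with
  | h0 => simpa [nablaPow_zero] using hf
  | hs β i ih =>
    rw [← nabla_nablaPow, map_add, Finsupp.degree_single]
    exact nabla_degGE i ih

theorem eq_of_forall_degGE {f g : DOp k d} (h : ∀ w, f - g ∈ degGE w) : f = g := by
  ext γ e
  have := h (γ.degree + funDeg e + 1) γ e (by omega)
  rwa [map_sub, map_sub, sub_eq_zero] at this

/-- The exponents of degree less than `w`. -/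
noncomputable def expLT (d w : ℕ) : Finset (Fin d →₀ ℕ) :=
  (Finsupp.finite_of_degree_lt w).toFinset

theorem mem_expLT {w : ℕ} {β : Fin d →₀ ℕ} : β ∈ expLT d w ↔ β.degree < w := by
  simp [expLT]

theorem coeff_opSum {w : ℕ} {u : (Fin d →₀ ℕ) → DOp k d} (hu : ∀ β, u β ∈ degGE β.degree)
    (γ e) (h : γ.degree + funDeg e < w) :
    MvPowerSeries.coeff e (coeff γ (opSum u)) =
      MvPowerSeries.coeff e (coeff γ (∑ β ∈ expLT d w, u β)) := by
  rw [map_sum, map_sum]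
  change (∑ᶠ β, MvPowerSeries.coeff e (coeff γ (u β))) = _
  refine finsum_eq_sum_of_support_subset _ fun β hβ => ?_
  rw [Finset.mem_coe, mem_expLT]
  by_contra hlt
  exact hβ (hu β γ e (by omega))

theorem opSum_sub_mem {u : (Fin d →₀ ℕ) → DOp k d} (hu : ∀ β, u β ∈ degGE β.degree) (w : ℕ) :
    opSum u - ∑ β ∈ expLT d w, u β ∈ degGE w := by
  intro γ e h
  rw [map_sub, map_sub, coeff_opSum hu γ e h, sub_self]

theorem term_mem (f g : DOp k d) (β) : coeff β f • nablaPow β g ∈ degGE β.degree := by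
  simpa using smul_degGE' (coeff β f) (nablaPow_degGE β (degGE_zero g))

theorem mul_sub_mem (f g : DOp k d) (w : ℕ) :
    f * g - ∑ β ∈ expLT d w, coeff β f • nablaPow β g ∈ degGE w :=
  opSum_sub_mem (term_mem f g) w

theorem opSum_add {u v : (Fin d →₀ ℕ) → DOp k d} (hu : ∀ β, u β ∈ degGE β.degree)
    (hv : ∀ β, v β ∈ degGE β.degree) : opSum (fun β => u β + v β) = opSum u + opSum v := by
  refine eq_of_forall_degGE fun w => ?_
  have h := sub_mem (opSum_sub_mem (u := fun β => u β + v β) (fun β => add_mem (hu β) (hv β)) w)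
    (add_mem (opSum_sub_mem hu w) (opSum_sub_mem hv w))
  rw [Finset.sum_add_distrib] at h
  convert h using 1
  abel

theorem mul_add' (f g h : DOp k d) : f * (g + h) = f * g + f * h := by
  simp only [mul_def, map_add, smul_add]
  exact opSum_add (term_mem f g) (term_mem f h)

theorem add_mul' (f g h : DOp k d) : (f + g) * h = f * h + g * h := by
  simp only [mul_def, map_add, add_smul]
  exact opSum_add (term_mem f h) (term_mem g h)

/-- Multiplication by `h` from the right, as an additive map. -/
noncomputable def mulRight (h : DOp k d) : DOp k d →+ DOp k d :=
  AddMonoidHom.mk' (fun f => f * h) fun f g => add_mul' f g h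

theorem mulRight_apply (f h : DOp k d) : mulRight h f = f * h := rfl

theorem mul_degGE {w : ℕ} {f : DOp k d} (hf : f ∈ degGE w) (g : DOp k d) : f * g ∈ degGE w := by
  have h := mul_sub_mem f g w
  have h2 : ∑ β ∈ expLT d w, coeff β f • nablaPow β g ∈ degGE w := by
    refine sum_mem fun β hβ => ?_
    rw [mem_expLT] at hβ
    have := smul_degGE (coeff_mem_funGE hf β) (nablaPow_degGE β (degGE_zero g))
    exact degGE_anti (by omega) this
  simpa using add_mem h h2

theorem smul_mul' (a : Fun k d) (f g : DOp k d) : (a • f) * g = a • (f * g) := by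
  refine eq_of_forall_degGE fun w => ?_
  have h1 := mul_sub_mem (a • f) g w
  have h2 := smul_degGE' a (mul_sub_mem f g w)
  simp only [coeff_smul', mul_smul, smul_sub, Finset.smul_sum] at h1 h2
  convert sub_mem h1 h2 using 1
  abel

theorem shift_mul (i : Fin d) (f g : DOp k d) :
    shift i f * g = opSum fun β => coeff β f • nablaPow (β + Finsupp.single i 1) g := by
  ext γ e
  change (∑ᶠ β, MvPowerSeries.coeff e (coeff γ (coeff β (shift i f) • nablaPow β g))) =
    ∑ᶠ β, MvPowerSeries.coeff e (coeff γ (coeff β f • nablaPow (β + Finsupp.single i 1) g))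
  have hinj : Function.Injective fun β : Fin d →₀ ℕ => β + Finsupp.single i 1 :=
    add_left_injective _
  set F : (Fin d →₀ ℕ) → k := fun β =>
    MvPowerSeries.coeff e (coeff γ (coeff β (shift i f) • nablaPow β g)) with hF
  have hr : (∑ᶠ β, F β) = ∑ᶠ β ∈ Set.range fun β : Fin d →₀ ℕ => β + Finsupp.single i 1, F β := by
    rw [← finsum_mem_univ]
    refine finsum_mem_inter_support_eq' F _ _ fun β h => ?_
    simp only [Set.mem_univ, Set.mem_range, true_iff]
    refine ⟨β - Finsupp.single i 1, tsub_add_cancel_of_le ?_⟩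
    rw [Finsupp.single_le_iff, Nat.one_le_iff_ne_zero]
    intro h0
    apply h
    simp [hF, coeff_shift, h0]
  rw [hr, finsum_mem_range hinj]
  refine finsum_congr fun β => ?_
  simp [hF, coeff_shift]

theorem nabla_smul (i : Fin d) (a : Fun k d) (f : DOp k d) :
    nabla i (a • f) = hpd i a • f + a • nabla i f := by
  ext1 γ
  simp only [nabla_apply, map_add, coeff_shift, coeff_hpdCoeff, coeff_smul', hpd_mul]
  split_ifs <;> ring

theorem nabla_mul (i : Fin d) (f g : DOp k d) : nabla i f * g = nabla i (f * g) := by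
  have e : nabla i f * g = opSum fun β => nabla i (coeff β f • nablaPow β g) := by
    rw [nabla_apply, add_mul', shift_mul, mul_def, ← opSum_add]
    · congr 1
      funext β
      rw [nabla_smul, nabla_nablaPow, coeff_hpdCoeff, add_comm]
    · intro β
      have := smul_degGE' (coeff β f) (nablaPow_degGE (β + Finsupp.single i 1) (degGE_zero g))
      refine degGE_anti ?_ this
      simp
    · exact term_mem _ _
  rw [e]
  refine eq_of_forall_degGE fun w => ?_
  have h1 := opSum_sub_mem (u := fun β => nabla i (coeff β f • nablaPow β g))
    (fun β => degGE_anti (Nat.le_succ _) (nabla_degGE i (term_mem f g β))) w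
  have h2 := degGE_anti (Nat.le_succ _) (nabla_degGE i (mul_sub_mem f g w))
  rw [map_sub, map_sum] at h2
  convert sub_mem h1 h2 using 1
  abel

theorem nablaPow_mul (β) (f g : DOp k d) : nablaPow β f * g = nablaPow β (f * g) := by
  induction β using exp_induction with
  | h0 => simp [nablaPow_zero]
  | hs β i ih => rw [← nabla_nablaPow, nabla_mul, ih, nabla_nablaPow]

theorem mul_assoc' (f g h : DOp k d) : f * g * h = f * (g * h) := by
  refine eq_of_forall_degGE fun w => ?_
  have h1 := mul_degGE (mul_sub_mem f g w) h
  have h2 := mul_sub_mem f (g * h) w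
  rw [← mulRight_apply, map_sub, map_sum] at h1
  simp only [mulRight_apply, smul_mul', nablaPow_mul] at h1
  convert sub_mem h1 h2 using 1
  abel

theorem coeff_ofFun (a : Fun k d) (γ) : coeff γ (ofFun a) = if γ = 0 then a else 0 := by
  classical
  exact MvPowerSeries.coeff_C γ a

theorem mul_one' (f : DOp k d) : f * 1 = f := by
  classical
  ext γ e
  change (∑ᶠ β, MvPowerSeries.coeff e (coeff γ (coeff β f • nablaPow β (1 : DOp k d)))) = _
  rw [finsum_eq_single _ γ]
  · simp [nablaPow_smul_one_coeff]
  · intro β hβ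
    simp [nablaPow_smul_one_coeff, hβ.symm]

theorem one_mul' (f : DOp k d) : 1 * f = f := by
  classical
  ext γ e
  change (∑ᶠ β, MvPowerSeries.coeff e (coeff γ (coeff β (ofFun 1) • nablaPow β f))) = _
  rw [finsum_eq_single _ 0]
  · simp [coeff_ofFun, nablaPow_zero]
  · intro β hβ
    simp [coeff_ofFun, hβ]

/-- `D` is an associative ring. -/
noncomputable instance : Ring (DOp k d) where
  __ := (inferInstance : AddCommGroup (DOp k d))
  left_distrib := mul_add'
  right_distrib := add_mul'
  zero_mul f := (mulRight f).map_zero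
  mul_zero f := (AddMonoidHom.mk' (fun g => f * g) (mul_add' f)).map_zero
  mul_assoc := mul_assoc'
  one_mul := one_mul'
  mul_one := mul_one'

/-! ### Action on functions and conjugation by a WKB expression -/

/-- The operator of multiplication by `x_i`. -/
noncomputable def x (i : Fin d) : DOp k d := ofFun (MvPowerSeries.X (some i))

/-- The action of a differential operator on a formal function:
`(∑_β f_β (ħ∂)^β)(φ) = ∑_β f_β · (ħ∂)^β φ`. -/
noncomputable def act (f : DOp k d) (φ : Fun k d) : Fun k d :=
  funSum fun β => coeff β f * (List.ofFn fun i => hpd i ^ β i).prod φ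

/-- For `s = S_0 + ∑_{g ≥ 1} ħ^g S_g` and `ψ = exp(s/ħ)`, the map `T_ψ`, informally
`f ↦ ψ⁻¹ f ψ`: the continuous endomorphism which fixes `ħ` and the `x_i`, and sends `ħ∂_i` to
`ħ∂_i + ∂_i s`. Thus `∑_β f_β (ħ∂)^β` is sent to `∑_β f_β ∏_i (ħ∂_i + ∂_i s)^{β_i}`; the factors
commute, and the sum is coefficientwise finite whenever `S_0` has no linear terms. -/
noncomputable def conj (s : Fun k d) (f : DOp k d) : DOp k d :=
  opSum fun β => coeff β f •
    (List.ofFn fun i => (p i + ofFun (MvPowerSeries.pderiv k (some i) s)) ^ β i).prod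

end DOp

/-! ### WKB solutions -/

section WKB

variable {k : Type*} [CommRing k] {d : ℕ}

/-- The formal function `S_0 + ∑_{g ≥ 1} ħ^g S_g`, for `S_g` in `k[[x]]`. -/
noncomputable def phase (S : ℕ → MvPowerSeries (Fin d) k) : Fun k d :=
  fun e => MvPowerSeries.coeff e.some (S (e none))

/-- The formal expression `ψ = exp(S_0/ħ + ∑_{g ≥ 1} ħ^{g-1} S_g)` satisfies `H_i(ψ) = 0` for all
`i`, that is, `T_ψ(H_i)(1) = 0` for all `i`. -/
def IsWKBSolution (H : Fin d → DOp k d) (S : ℕ → MvPowerSeries (Fin d) k) : Prop :=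
  ∀ i, (DOp.conj (phase S) (H i)).act 1 = 0

/-- The normalization `S_{0,≤2} = 0` and `S_{g,0} = 0` for all `g`, where `S_{g,n}` is the
homogeneous part of degree `n` of `S_g`. -/
def IsNormalized (S : ℕ → MvPowerSeries (Fin d) k) : Prop :=
  (∀ m : Fin d →₀ ℕ, m.degree ≤ 2 → MvPowerSeries.coeff m (S 0) = 0) ∧
    ∀ g, MvPowerSeries.coeff 0 (S g) = 0

/-- The Taylor coefficient `∂_{i_1} ⋯ ∂_{i_n} f (0)`. -/
noncomputable def taylor (f : MvPowerSeries (Fin d) k) {n : ℕ} (idx : Fin n → Fin d) : k :=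
  MvPowerSeries.constantCoeff
    ((List.ofFn idx).foldr (fun i h => MvPowerSeries.pderiv k i h) f)

end WKB

/-! ### Quantum Airy structures and the abstract topological recursion -/

/-- The Hamiltonian
`H_i = -ħ∂_i + ∑ a_{ijl} x_j x_l + 2 ∑ b_{ij}^l x_j ħ∂_l + ∑ c_i^{jl} ħ∂_j ħ∂_l + ħ ε_i`,
where `b i j l = b_{ij}^l` and `c i j l = c_i^{jl}`. -/
noncomputable def airyH {k : Type*} [CommRing k] {d : ℕ} (a b c : Fin d → Fin d → Fin d → k)
    (ε : Fin d → k) (i : Fin d) : DOp k d :=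
  -DOp.p i + ∑ j, ∑ l, (MvPowerSeries.C (a i j l) : Fun k d) • (DOp.x j * DOp.x l)
    + ∑ j, ∑ l, (MvPowerSeries.C (2 * b i j l) : Fun k d) • (DOp.x j * DOp.p l)
    + ∑ j, ∑ l, (MvPowerSeries.C (c i j l) : Fun k d) • (DOp.p j * DOp.p l)
    + (hbarF k d * MvPowerSeries.C (ε i)) • (1 : DOp k d)

/-- A quantum Airy structure on `k^d`: tensors `A, B, C, ε`, with `A` and `C` symmetric in the last
two indices, such that the span over `k` of the Hamiltonians `H_i` is closed under the Lie bracket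
`(f g - g f)/ħ`. -/
structure QuantumAiry (k : Type*) [CommRing k] (d : ℕ) where
  /-- `a i j l = a_{ijl}` -/
  a : Fin d → Fin d → Fin d → k
  /-- `b i j l = b_{ij}^l` -/
  b : Fin d → Fin d → Fin d → k
  /-- `c i j l = c_i^{jl}` -/
  c : Fin d → Fin d → Fin d → k
  /-- `ε i = ε_i` -/
  ε : Fin d → k
  a_symm : ∀ i j l, a i j l = a i l j
  c_symm : ∀ i j l, c i j l = c i l j
  closed : ∀ i j, ∃ g : Fin d → k,
    airyH a b c ε i * airyH a b c ε j - airyH a b c ε j * airyH a b c ε i =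
      hbarF k d • ∑ l, (MvPowerSeries.C (g l) : Fun k d) • airyH a b c ε l

/-- The Hamiltonians of a quantum Airy structure. -/
noncomputable def QuantumAiry.H {k : Type*} [CommRing k] {d : ℕ} (Q : QuantumAiry k d) :
    Fin d → DOp k d := airyH Q.a Q.b Q.c Q.ε

/-- A choice, for every subset `J` of `{1, …, m}`, of an enumeration of the elements of `J`. -/
abbrev Enumeration : Type := ∀ (m : ℕ) (J : Finset (Fin m)), Fin J.card ≃ J

/-- The sequence `i_J = (i_{α_1}, …, i_{α_{#J}})`, where `J = {α_1, …, α_{#J}}` is enumerated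
by `en`. -/
def Enumeration.sub (en : Enumeration) {d m : ℕ} (idx : Fin m → Fin d) (J : Finset (Fin m)) :
    Fin J.card → Fin d := fun r => idx (en m J r)

/-- The family of tensors `T g n = S_{g,n}` is produced by the abstract topological recursion of the
quantum Airy structure `Q`, the sequences `i_J` being formed with the enumerations `en`. Here
`S_{g,n}` is taken to be zero if neither `g = 0, n ≥ 3` nor `g ≥ 1, n ≥ 1`. -/
structure IsATR {k : Type*} [CommRing k] {d : ℕ} (Q : QuantumAiry k d) (en : Enumeration)
    (T : ∀ (_ n : ℕ), (Fin n → Fin d) → k) : Prop where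
  zero_of_le : ∀ n ≤ 2, ∀ idx, T 0 n idx = 0
  zero_right : ∀ g idx, T g 0 idx = 0
  init_03 : ∀ idx, T 0 3 idx = 2 * Q.a (idx 0) (idx 1) (idx 2)
  init_11 : ∀ idx, T 1 1 idx = Q.ε (idx 0)
  step : ∀ g m : ℕ, (g = 0 ∧ 4 ≤ m + 1) ∨ (g = 1 ∧ 2 ≤ m + 1) ∨ 2 ≤ g →
    ∀ (i : Fin d) (idx : Fin m → Fin d),
      T g (m + 1) (Matrix.vecCons i idx) =
        2 * ∑ α : Fin m, ∑ l, Q.b i (idx α) l *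
            T g _ (Matrix.vecCons l (en.sub idx (Finset.univ.erase α)))
        + ∑ gg ∈ Finset.HasAntidiagonal.antidiagonal g, ∑ J : Finset (Fin m), ∑ j, ∑ l, Q.c i j l *
            T gg.1 _ (Matrix.vecCons j (en.sub idx J)) *
            T gg.2 _ (Matrix.vecCons l (en.sub idx Jᶜ))
        + if g = 0 then 0 else ∑ j, ∑ l, Q.c i j l *
            T (g - 1) (m + 2) (Matrix.vecCons j (Matrix.vecCons l idx))

end HbarDiff

open HbarDiff

namespace HbarDiff

/-! ### The degree filtration on formal functions. -/

section Estimates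

variable {k : Type*} [CommRing k] {d : ℕ}

/-! Put `s = S_0 + ∑ ħ^g S_g`. Replacing every `ħ∂_i` by `ħ∂_i + ∂_i s` makes `D` act on formal
functions as soon as `s` has degree at least 2 (`twistAct_mul`), and `T_ψ(f)(1)` is the value of
this twisted action at `1` (`conj_act_one`). The equations become `u_i = 0` for the residuals `u_i =
-∂_i s + P_i·1`, where the dot is the twisted action.

Contracting with `x_i` gives `E s = ∑ x_i (P_i·1)` for the Euler field `E = ∑ x_i ∂_i`. The
normalization says that `s` has degree at least 3 and no terms free of `x`, so in characteristic
zero `E` can be inverted and `s` is a fixed point of `Ψ(s) = E⁻¹ ∑ x_i (P_i·1)`. As `P_i` has degree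
at least 2, a change of `s` in degrees `≥ w` changes `P_i·1` in degrees `≥ w`
(`twistAct_one_sub_mem`), and the factor `x_i` gains one more. Thus `Ψ` is a contraction for the
degree filtration: it has exactly one fixed point, which already gives uniqueness.

For existence, the fixed point only yields `∑ x_i u_i = 0`. Applying the commutator relations to `1`
shows that, if all `u_i` have degree `≥ w`, then so do all `∂_i u_j - ∂_j u_i`. Differentiating `∑
x_i u_i = 0` gives `(E + 1) u_j = ∑ x_i (∂_i u_j - ∂_j u_i)`, so the `u_j` have degree `≥ w + 1`
(`mem_funGE_of_closed`). By induction they vanish.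

A quantum Airy structure is a special case. The `ħ^g` coefficient of its equations is a differential
equation for `S_g`, whose derivatives at `0` are the recursion (`taylor_recursion`). The recursion
determines its solution by induction on `2g + n` (`IsATR.unique`). -/

theorem funDeg_eq (e : Option (Fin d) →₀ ℕ) : funDeg e = 2 * e none + e.some.degree := by
  simp [funDeg, Finsupp.weight_apply, Finsupp.sum_fintype, Finsupp.degree_eq_sum, mul_comm]

theorem funDeg_single_some (i : Fin d) (n : ℕ) :
    funDeg (Finsupp.single (some i) n) = n := by
  simp [funDeg, Finsupp.weight_single]

theorem funGE_anti {v w : ℕ} (h : v ≤ w) {f : Fun k d} (hf : f ∈ funGE w) : f ∈ funGE v :=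
  fun e he => hf e (by omega)

theorem mul_funGE {v w : ℕ} {a b : Fun k d} (ha : a ∈ funGE v) (hb : b ∈ funGE w) :
    a * b ∈ funGE (v + w) := by
  classical
  intro e he
  rw [MvPowerSeries.coeff_mul]
  refine Finset.sum_eq_zero fun x hx => ?_
  rw [Finset.HasAntidiagonal.mem_antidiagonal] at hx
  have hd : funDeg x.1 + funDeg x.2 = funDeg e := by rw [← map_add, hx]
  by_cases h : funDeg x.1 < v
  · rw [ha _ h, zero_mul]
  · rw [hb x.2 (by omega), mul_zero]

theorem mul_funGE' {w : ℕ} (a : Fun k d) {b : Fun k d} (hb : b ∈ funGE w) : a * b ∈ funGE w := by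
  simpa using mul_funGE (DOp.funGE_zero a) hb

theorem eq_of_forall_funGE {f g : Fun k d} (h : ∀ w, f - g ∈ funGE w) : f = g := by
  ext e
  have := h (funDeg e + 1) e (by omega)
  rwa [map_sub, sub_eq_zero] at this

theorem pderiv_funGE {w : ℕ} (i : Fin d) {f : Fun k d} (hf : f ∈ funGE (w + 1)) :
    MvPowerSeries.pderiv k (some i) f ∈ funGE w := by
  intro e he
  rw [MvPowerSeries.coeff_pderiv, hf _ (by rw [map_add, funDeg_single_some]; omega), zero_mul]

theorem X_mem_funGE (i : Fin d) : (MvPowerSeries.X (some i) : Fun k d) ∈ funGE 1 := by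
  classical
  intro e he
  rw [MvPowerSeries.coeff_X, if_neg]
  rintro rfl
  rw [funDeg_single_some] at he
  omega

theorem hbar_mem_funGE : hbarF k d ∈ funGE 2 := by
  classical
  intro e he
  rw [MvPowerSeries.coeff_X, if_neg]
  rintro rfl
  simp [funDeg, Finsupp.weight_single] at he

theorem mem_funGE_of_hbar_mul {w : ℕ} {f : Fun k d} (hf : hbarF k d * f ∈ funGE (w + 2)) :
    f ∈ funGE w := by
  intro e he
  have h := hf (Finsupp.single none 1 + e) (by
    rw [map_add, funDeg_eq (Finsupp.single none 1)]
    simp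
    omega)
  rw [hbarF, MvPowerSeries.X_def, MvPowerSeries.coeff_add_monomial_mul] at h
  simpa using h

/-- The degree bound makes the sum coefficientwise finite. Identities between infinite sums are
proved below by truncating to finite sums modulo each degree. -/
theorem funSum_sub_mem {u : (Fin d →₀ ℕ) → Fun k d} (hu : ∀ β, u β ∈ funGE β.degree) (w : ℕ) :
    funSum u - ∑ β ∈ DOp.expLT d w, u β ∈ funGE w := by
  intro e he
  rw [map_sub, sub_eq_zero, map_sum]
  change (∑ᶠ β, MvPowerSeries.coeff e (u β)) = _
  refine finsum_eq_sum_of_support_subset _ fun β hβ => ?_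
  rw [Finset.mem_coe, DOp.mem_expLT]
  by_contra hlt
  exact hβ (hu β e (by omega))

theorem funSum_mem {u : (Fin d →₀ ℕ) → Fun k d} {w : ℕ} (h : ∀ β, u β ∈ funGE w) :
    funSum u ∈ funGE w := by
  intro e he
  change (∑ᶠ β, MvPowerSeries.coeff e (u β)) = _
  rw [finsum_congr fun β => h β e he, finsum_zero]

theorem funSum_add {u v : (Fin d →₀ ℕ) → Fun k d} (hu : ∀ β, u β ∈ funGE β.degree)
    (hv : ∀ β, v β ∈ funGE β.degree) : funSum (fun β => u β + v β) = funSum u + funSum v := by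
  refine eq_of_forall_funGE fun w => ?_
  have h1 := funSum_sub_mem hu w
  have h2 := funSum_sub_mem hv w
  have h3 := funSum_sub_mem (fun β => add_mem (hu β) (hv β)) w
  rw [Finset.sum_add_distrib] at h3
  convert sub_mem h3 (add_mem h1 h2) using 1
  abel

theorem funSum_single {u : (Fin d →₀ ℕ) → Fun k d} (β : Fin d →₀ ℕ)
    (h : ∀ γ, γ ≠ β → u γ = 0) : funSum u = u β := by
  ext e
  change (∑ᶠ γ, MvPowerSeries.coeff e (u γ)) = _
  rw [finsum_eq_single _ β]
  intro γ hγ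
  rw [h γ hγ, map_zero]

end Estimates

/-! ### The conjugated operators as twisted operators on functions. -/

section Conjugation

variable {k : Type*} [CommRing k] {d : ℕ}

/-- The operator `ħ∂_i + ∂_i s` on formal functions. -/
noncomputable def twist (s : Fun k d) (i : Fin d) : AddMonoid.End (Fun k d) :=
  hpd i + AddMonoid.End.mulLeft (MvPowerSeries.pderiv k (some i) s)

/-- The operator `∏_i (ħ∂_i + ∂_i s)^{β_i}` on formal functions. -/
noncomputable def twistPow (s : Fun k d) (β : Fin d →₀ ℕ) : AddMonoid.End (Fun k d) :=
  (List.ofFn fun i => twist s i ^ β i).prod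

/-- The action of the conjugated operator `T_ψ(f)` on formal functions, where `ψ = exp(s/ħ)`. -/
noncomputable def twistAct (s : Fun k d) (f : DOp k d) (φ : Fun k d) : Fun k d :=
  funSum fun β => DOp.coeff β f * twistPow s β φ

theorem twist_apply (s : Fun k d) (i : Fin d) (φ : Fun k d) :
    twist s i φ = hpd i φ + MvPowerSeries.pderiv k (some i) s * φ := rfl

theorem pderiv_comm {σ : Type*} (i j : σ) (f : MvPowerSeries σ k) :
    MvPowerSeries.pderiv k i (MvPowerSeries.pderiv k j f) =
      MvPowerSeries.pderiv k j (MvPowerSeries.pderiv k i f) := by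
  classical
  ext n
  simp only [MvPowerSeries.coeff_pderiv]
  by_cases hij : i = j
  · subst hij; rfl
  · have hji : j ≠ i := fun h => hij h.symm
    simp only [Finsupp.add_apply, ne_eq, hij, hji, not_false_eq_true,
      Finsupp.single_eq_of_ne, add_zero, add_right_comm n]
    ring

/-- The only cross terms, `ħ ∂_i ∂_j s`, are symmetric in `i` and `j`. -/
theorem twist_comm (s : Fun k d) (i j : Fin d) : Commute (twist s i) (twist s j) := by
  refine AddMonoidHom.ext fun φ => ?_
  change twist s i (twist s j φ) = twist s j (twist s i φ)
  simp only [twist_apply, map_add, DOp.hpd_mul, DOp.hpd_comm i j]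
  simp only [DOp.hpd_apply, pderiv_comm (some i) (some j) s]
  ring

theorem twist_twistPow (s : Fun k d) (i : Fin d) (β : Fin d →₀ ℕ) (φ : Fun k d) :
    twist s i (twistPow s β φ) = twistPow s (β + Finsupp.single i 1) φ := by
  have h := DOp.list_prod_comm (fun j => twist s j) (twist_comm s) β i
  have h' : twist s i * twistPow s β = twistPow s (β + Finsupp.single i 1) := by
    rw [twistPow, h, twistPow]
    simp [Finsupp.single_apply]
  exact DFunLike.congr_fun h' φ

theorem twistPow_zero (s φ : Fun k d) : twistPow s 0 φ = φ := by
  simp [twistPow]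

theorem twist_mul (s : Fun k d) (i : Fin d) (a φ : Fun k d) :
    twist s i (a * φ) = hpd i a * φ + a * twist s i φ := by
  simp only [twist_apply, DOp.hpd_mul]
  ring

theorem coeff_zero_nabla (i : Fin d) (f : DOp k d) :
    DOp.coeff 0 (DOp.nabla i f) = hpd i (DOp.coeff 0 f) := by
  simp [DOp.nabla_apply, DOp.coeff_shift, DOp.coeff_hpdCoeff]

theorem p_eq_nabla (i : Fin d) : (DOp.p i : DOp k d) = DOp.nabla i 1 := by
  classical
  have h := DOp.nablaPow_smul_one_coeff (k := k) (d := d) (Finsupp.single i 1)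
  rw [← zero_add (Finsupp.single i 1), ← DOp.nabla_nablaPow, DOp.nablaPow_zero, zero_add] at h
  ext1 γ
  rw [h γ]
  exact MvPowerSeries.coeff_X γ i

theorem p_mul (i : Fin d) (f : DOp k d) : DOp.p i * f = DOp.nabla i f := by
  rw [p_eq_nabla, DOp.nabla_mul, one_mul]

theorem ofFun_eq (a : Fun k d) : DOp.ofFun a = a • (1 : DOp k d) := by
  ext1 γ
  rw [DOp.coeff_smul', DOp.one_def, DOp.coeff_ofFun, DOp.coeff_ofFun]
  split_ifs <;> simp

theorem ofFun_mul (a : Fun k d) (f : DOp k d) : DOp.ofFun a * f = a • f := by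
  rw [ofFun_eq, DOp.smul_mul', one_mul]

/-- Taking the coefficient of `(ħ∂)^0` amounts to applying an operator to `1`. This turns products
in `D` into compositions on functions without proving that `T_ψ` is multiplicative. -/
theorem coeff_zero_momentum (s : Fun k d) (i : Fin d) (f : DOp k d) :
    DOp.coeff 0 ((DOp.p i + DOp.ofFun (MvPowerSeries.pderiv k (some i) s)) * f) =
      twist s i (DOp.coeff 0 f) := by
  rw [add_mul, map_add, p_mul, coeff_zero_nabla, ofFun_mul, DOp.coeff_smul', twist_apply]

/-- The relabelling `ι` is there for the induction on the length of the list, whose tail is indexed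
by `Fin.succ`. -/
theorem coeff_zero_list (s : Fun k d) {n : ℕ} (ι : Fin n → Fin d) (b : Fin n → ℕ) (f : DOp k d) :
    DOp.coeff 0 ((List.ofFn fun i =>
      (DOp.p (ι i) + DOp.ofFun (MvPowerSeries.pderiv k (some (ι i)) s)) ^ b i).prod * f) =
      (List.ofFn fun i => twist s (ι i) ^ b i).prod (DOp.coeff 0 f) := by
  have hpow : ∀ (i : Fin d) (n : ℕ) (f : DOp k d),
      DOp.coeff 0 ((DOp.p i + DOp.ofFun (MvPowerSeries.pderiv k (some i) s)) ^ n * f) =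
        (twist s i ^ n) (DOp.coeff 0 f) := by
    intro i n
    induction n with
    | zero => intro f; simp
    | succ n ih =>
      intro f
      rw [pow_succ, mul_assoc, ih, coeff_zero_momentum, pow_succ]
      rfl
  induction n with
  | zero => simp
  | succ n ih =>
    simp only [List.ofFn_succ, List.prod_cons]
    rw [mul_assoc, hpow, ih (fun j => ι j.succ) (fun j => b j.succ)]
    rfl

theorem act_one (f : DOp k d) : f.act 1 = DOp.coeff 0 f := by
  have hz : ∀ i : Fin d, hpd i (1 : Fun k d) = 0 := fun i => by simp [DOp.hpd_apply]
  have hc : ∀ i j : Fin d, Commute (hpd (k := k) i) (hpd j) := fun i j =>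
    AddMonoidHom.ext fun φ => DOp.hpd_comm i j φ
  rw [DOp.act, funSum_single 0]
  · simp
  · intro γ hγ
    obtain ⟨i, hi⟩ : ∃ i, γ i ≠ 0 := by
      by_contra! h
      exact hγ (Finsupp.ext h)
    have key : ∀ (n : ℕ) (ι : Fin n → Fin d) (b : Fin n → ℕ) (i : Fin n), b i ≠ 0 →
        (List.ofFn fun j => hpd (k := k) (ι j) ^ b j).prod 1 = 0 := by
      intro n
      induction n with
      | zero => exact fun _ _ i => i.elim0
      | succ n ih =>
        intro ι b i hi
        have hp : ∀ (j : Fin d) (m : ℕ), m ≠ 0 → (hpd (k := k) j ^ m) 1 = 0 := by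
          intro j m hm
          obtain ⟨m, rfl⟩ := Nat.exists_eq_succ_of_ne_zero hm
          rw [pow_succ]
          change (hpd j ^ m) (hpd j 1) = 0
          rw [hz, map_zero]
        simp only [List.ofFn_succ, List.prod_cons]
        refine Fin.cases (fun h0 => ?_) (fun j hj => ?_) i hi
        -- The derivatives commute, so the nontrivial power at the head can be moved to act first,
        -- where it kills `1`.
        · have : Commute (hpd (k := k) (ι 0) ^ b 0)
              (List.ofFn fun j : Fin n => hpd (k := k) (ι j.succ) ^ b j.succ).prod := by
            refine Commute.list_prod_right _ _ fun y hy => ?_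
            obtain ⟨j, rfl⟩ := (List.mem_ofFn).1 hy
            exact (hc _ _).pow_pow _ _
          rw [this.eq]
          change (List.ofFn fun j : Fin n => hpd (k := k) (ι j.succ) ^ b j.succ).prod
            ((hpd (ι 0) ^ b 0) 1) = 0
          rw [hp _ _ h0, map_zero]
        · change (hpd (ι 0) ^ b 0)
            ((List.ofFn fun j : Fin n => hpd (k := k) (ι j.succ) ^ b j.succ).prod 1) = 0
          rw [ih _ _ j hj, map_zero]
    have h := key d id γ i hi
    simp only [id] at h
    rw [h, mul_zero]

theorem conj_act_one (s : Fun k d) (f : DOp k d) : (DOp.conj s f).act 1 = twistAct s f 1 := by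
  rw [act_one]
  change (funSum fun β => DOp.coeff 0 (DOp.coeff β f • (List.ofFn fun i =>
    (DOp.p i + DOp.ofFun (MvPowerSeries.pderiv k (some i) s)) ^ β i).prod)) = _
  rw [twistAct]
  congr 1
  funext β
  have h := coeff_zero_list s id β 1
  rw [mul_one] at h
  rw [DOp.coeff_smul']
  exact congrArg (DOp.coeff β f * ·) h

end Conjugation

/-! ### The twisted action is a module structure, and depends on the phase in a contracting way. -/

section TwistedAction

variable {k : Type*} [CommRing k] {d : ℕ} {s : Fun k d}

/-- Both summands gain one degree: `ħ∂_i` gains `2 - 1`, and `∂_i s` has degree at least 1 because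
`s` has degree at least 2. -/
theorem twist_mem (hs : s ∈ funGE 2) (i : Fin d) {w : ℕ} {φ : Fun k d} (hφ : φ ∈ funGE w) :
    twist s i φ ∈ funGE (w + 1) := by
  rw [twist_apply]
  refine add_mem (DOp.hpd_funGE i hφ) ?_
  rw [add_comm]
  exact mul_funGE (pderiv_funGE i hs) hφ

theorem twistPow_mem (hs : s ∈ funGE 2) (β : Fin d →₀ ℕ) {w : ℕ} {φ : Fun k d}
    (hφ : φ ∈ funGE w) : twistPow s β φ ∈ funGE (w + β.degree) := by
  induction β using DOp.exp_induction with
  | h0 => simpa [twistPow_zero] using hφ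
  | hs β i ih =>
    rw [← twist_twistPow, map_add, Finsupp.degree_single]
    exact twist_mem hs i ih

theorem twistAct_term_mem (hs : s ∈ funGE 2) (f : DOp k d) (φ : Fun k d) (β : Fin d →₀ ℕ) :
    DOp.coeff β f * twistPow s β φ ∈ funGE β.degree := by
  simpa using mul_funGE' (DOp.coeff β f) (twistPow_mem hs β (DOp.funGE_zero φ))

theorem twistAct_sub_mem (hs : s ∈ funGE 2) (f : DOp k d) (φ : Fun k d) (w : ℕ) :
    twistAct s f φ - ∑ β ∈ DOp.expLT d w, DOp.coeff β f * twistPow s β φ ∈ funGE w :=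
  funSum_sub_mem (twistAct_term_mem hs f φ) w

theorem twistAct_mem (hs : s ∈ funGE 2) {v w : ℕ} {f : DOp k d} {φ : Fun k d}
    (hf : f ∈ DOp.degGE v) (hφ : φ ∈ funGE w) : twistAct s f φ ∈ funGE (v + w) :=
  funSum_mem fun β => funGE_anti (by omega)
    (mul_funGE (DOp.coeff_mem_funGE hf β) (twistPow_mem hs β hφ))

theorem twistAct_add (hs : s ∈ funGE 2) (f g : DOp k d) (φ : Fun k d) :
    twistAct s (f + g) φ = twistAct s f φ + twistAct s g φ := by
  rw [twistAct, twistAct, twistAct, ← funSum_add (twistAct_term_mem hs f φ)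
    (twistAct_term_mem hs g φ)]
  simp only [map_add, add_mul]

/-- `twistAct` as an additive map in the operator. -/
noncomputable def twistActHom (hs : s ∈ funGE 2) (φ : Fun k d) : DOp k d →+ Fun k d :=
  AddMonoidHom.mk' (fun f => twistAct s f φ) fun f g => twistAct_add hs f g φ

theorem twistActHom_apply (hs : s ∈ funGE 2) (φ : Fun k d) (f : DOp k d) :
    twistActHom hs φ f = twistAct s f φ := rfl

theorem twistAct_smul (hs : s ∈ funGE 2) (a : Fun k d) (f : DOp k d) (φ : Fun k d) :
    twistAct s (a • f) φ = a * twistAct s f φ := by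
  refine eq_of_forall_funGE fun w => ?_
  have h1 := twistAct_sub_mem hs (a • f) φ w
  have h2 := mul_funGE' a (twistAct_sub_mem hs f φ w)
  rw [mul_sub, Finset.mul_sum] at h2
  simp only [DOp.coeff_smul', mul_assoc] at h1
  convert sub_mem h1 h2 using 1
  abel

theorem twistAct_nablaPow_one (β : Fin d →₀ ℕ) (φ : Fun k d) :
    twistAct s (DOp.nablaPow β 1) φ = twistPow s β φ := by
  rw [twistAct, funSum_single β]
  · simp [DOp.nablaPow_smul_one_coeff]
  · intro γ hγ
    simp [DOp.nablaPow_smul_one_coeff, hγ]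

theorem twistAct_one (φ : Fun k d) : twistAct s (1 : DOp k d) φ = φ := by
  rw [← DOp.nablaPow_zero (1 : DOp k d), twistAct_nablaPow_one, twistPow_zero]

theorem twistAct_nabla (hs : s ∈ funGE 2) (i : Fin d) (f : DOp k d) (φ : Fun k d) :
    twistAct s (DOp.nabla i f) φ = twist s i (twistAct s f φ) := by
  refine eq_of_forall_funGE fun w => ?_
  -- Writing `f` as `f * 1` approximates it by finitely many normally ordered monomials. On these
  -- the claim is the Leibniz rule `twist_mul`.
  have h0 := DOp.mul_sub_mem f 1 w
  rw [mul_one] at h0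
  have h1 := twist_mem hs i (twistAct_mem hs h0 (DOp.funGE_zero φ))
  have h2 := twistAct_mem hs (DOp.nabla_degGE i h0) (DOp.funGE_zero φ)
  have e : twistAct s (DOp.nabla i (∑ β ∈ DOp.expLT d w, DOp.coeff β f • DOp.nablaPow β 1)) φ =
      twist s i (twistAct s (∑ β ∈ DOp.expLT d w, DOp.coeff β f • DOp.nablaPow β 1) φ) := by
    rw [← twistActHom_apply hs, ← twistActHom_apply hs]
    simp only [map_sum]
    refine Finset.sum_congr rfl fun β _ => ?_
    simp only [twistActHom_apply, DOp.nabla_smul, twistAct_add hs, twistAct_smul hs,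
      DOp.nabla_nablaPow, twistAct_nablaPow_one, twist_mul, twist_twistPow]
  rw [map_sub, ← twistActHom_apply hs, map_sub, twistActHom_apply, twistActHom_apply, e] at h2
  rw [← twistActHom_apply hs, map_sub, map_sub, twistActHom_apply, twistActHom_apply] at h1
  refine funGE_anti (v := w) (w := w + 1) (by omega) ?_
  convert sub_mem h2 h1 using 1
  abel

theorem twistAct_nablaPow (hs : s ∈ funGE 2) (β : Fin d →₀ ℕ) (f : DOp k d) (φ : Fun k d) :
    twistAct s (DOp.nablaPow β f) φ = twistPow s β (twistAct s f φ) := by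
  induction β using DOp.exp_induction with
  | h0 => rw [DOp.nablaPow_zero, twistPow_zero]
  | hs β i ih => rw [← DOp.nabla_nablaPow, twistAct_nabla hs, ih, twist_twistPow]

/-- Modulo each degree, `f * g` is a finite sum of terms `f_β (ħ∂)^β ∘ g`, and the action is already
known to be compatible with left composition by `(ħ∂)^β`. -/
theorem twistAct_mul (hs : s ∈ funGE 2) (f g : DOp k d) (φ : Fun k d) :
    twistAct s (f * g) φ = twistAct s f (twistAct s g φ) := by
  refine eq_of_forall_funGE fun w => ?_
  have h1 := twistAct_mem hs (DOp.mul_sub_mem f g w) (DOp.funGE_zero φ)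
  have h2 := twistAct_sub_mem hs f (twistAct s g φ) w
  rw [← twistActHom_apply hs, map_sub, map_sum, add_zero] at h1
  simp only [twistActHom_apply, twistAct_smul hs, twistAct_nablaPow hs] at h1
  convert sub_mem h1 h2 using 1
  abel

theorem twistAct_p (hs : s ∈ funGE 2) (i : Fin d) (φ : Fun k d) :
    twistAct s (DOp.p i) φ = twist s i φ := by
  rw [p_eq_nabla, twistAct_nabla hs, twistAct_one]

/-- Differences telescope: one factor becomes `∂_i (s - s')`, of degree `w - 1`, and the other `|β|
- 1` factors gain one degree each. For `β = 0` the difference is zero. -/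
theorem twistPow_sub_mem {s' : Fun k d} (hs : s ∈ funGE 3) (hs' : s' ∈ funGE 3) {w : ℕ}
    (hw : 3 ≤ w) (h : s - s' ∈ funGE w) (β : Fin d →₀ ℕ) :
    twistPow s β 1 - twistPow s' β 1 ∈ funGE (w + β.degree - 2) := by
  obtain ⟨w, rfl⟩ : ∃ v, w = v + 2 := ⟨w - 2, by omega⟩
  induction β using DOp.exp_induction with
  | h0 => rw [twistPow_zero, twistPow_zero, sub_self]; exact zero_mem _
  | hs β i ih =>
    have h2 : (2 : ℕ) ≤ 3 := by norm_num
    have e : twistPow s (β + Finsupp.single i 1) 1 - twistPow s' (β + Finsupp.single i 1) 1 =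
        twist s i (twistPow s β 1 - twistPow s' β 1) +
          MvPowerSeries.pderiv k (some i) (s - s') * twistPow s' β 1 := by
      rw [← twist_twistPow, ← twist_twistPow, map_sub]
      simp only [twist_apply, map_sub]
      ring
    rw [e, map_add, Finsupp.degree_single]
    refine add_mem (funGE_anti (by omega) (twist_mem (funGE_anti h2 hs) i ih)) ?_
    exact funGE_anti (by omega) (mul_funGE (pderiv_funGE i h)
      (twistPow_mem (funGE_anti h2 hs') β (DOp.funGE_zero 1)))

/-- The coefficient of `(ħ∂)^β` in `P` has degree at least `2 - |β|`, which makes up for the `|β| -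
2` in `twistPow_sub_mem`. -/
theorem twistAct_one_sub_mem {s' : Fun k d} (hs : s ∈ funGE 3) (hs' : s' ∈ funGE 3) {w : ℕ}
    (hw : 3 ≤ w) (h : s - s' ∈ funGE w) {P : DOp k d} (hP : P ∈ DOp.degGE 2) :
    twistAct s P 1 - twistAct s' P 1 ∈ funGE w := by
  have h2 : (2 : ℕ) ≤ 3 := by norm_num
  have h1 := sub_mem (twistAct_sub_mem (funGE_anti h2 hs) P 1 w)
    (twistAct_sub_mem (funGE_anti h2 hs') P 1 w)
  have h3 : ∑ β ∈ DOp.expLT d w, DOp.coeff β P * (twistPow s β 1 - twistPow s' β 1) ∈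
      funGE (k := k) (d := d) w :=
    sum_mem fun β _ => funGE_anti (by omega)
      (mul_funGE (DOp.coeff_mem_funGE hP β) (twistPow_sub_mem hs hs' hw h β))
  simp only [mul_sub, Finset.sum_sub_distrib] at h3
  convert add_mem h1 h3 using 1
  abel

end TwistedAction

/-! ### Phases versus families `S_g`, and the normalization. -/

section Phase

variable {k : Type*} [CommRing k] {d : ℕ}

/-- The coefficient of `ħ^g` in a formal function, as a series in the `x_i`. -/
noncomputable def slice (g : ℕ) : Fun k d →ₗ[k] MvPowerSeries (Fin d) k where
  toFun f := fun m => MvPowerSeries.coeff (m.optionElim g) f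
  map_add' _ _ := rfl
  map_smul' _ _ := rfl

theorem coeff_slice (g : ℕ) (f : Fun k d) (m : Fin d →₀ ℕ) :
    MvPowerSeries.coeff m (slice g f) = MvPowerSeries.coeff (m.optionElim g) f := rfl

theorem coeff_phase (S : ℕ → MvPowerSeries (Fin d) k) (e : Option (Fin d) →₀ ℕ) :
    MvPowerSeries.coeff e (phase S) = MvPowerSeries.coeff e.some (S (e none)) := rfl

theorem phase_slice (s : Fun k d) : phase (fun g => slice g s) = s := by
  ext e
  rw [coeff_phase, coeff_slice, Finsupp.optionElim_some]

theorem slice_phase (S : ℕ → MvPowerSeries (Fin d) k) (g : ℕ) : slice g (phase S) = S g := by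
  ext m
  rw [coeff_slice, coeff_phase, Finsupp.some_optionElim, Finsupp.optionElim_apply_none]

theorem phase_injective : Function.Injective (phase (k := k) (d := d)) := fun S S' h => by
  funext g
  rw [← slice_phase S, h, slice_phase]

/-- The monomials `ħ^c x^m` with `2c + |m| < 3` are those with `c = 0`, `|m| ≤ 2`, together with `ħ`
itself, which is excluded by `S_{1,0} = 0`. -/
theorem isNormalized_iff (S : ℕ → MvPowerSeries (Fin d) k) :
    IsNormalized S ↔ phase S ∈ funGE 3 ∧
      ∀ e : Option (Fin d) →₀ ℕ, e.some = 0 → MvPowerSeries.coeff e (phase S) = 0 := by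
  constructor
  · rintro ⟨h1, h2⟩
    refine ⟨fun e he => ?_, fun e he => ?_⟩
    · rw [funDeg_eq] at he
      rw [coeff_phase]
      rcases Nat.eq_zero_or_pos (e none) with h | h
      · rw [h]
        exact h1 _ (by omega)
      · have : e.some = 0 := by
          rw [← Finsupp.degree_eq_zero_iff]
          omega
        rw [this]
        exact h2 _
    · rw [coeff_phase, he, h2]
  · rintro ⟨h1, h2⟩
    refine ⟨fun m hm => ?_, fun g => ?_⟩
    · have := h1 (m.optionElim 0) (by
        rw [funDeg_eq, Finsupp.some_optionElim, Finsupp.optionElim_apply_none]; omega)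
      rwa [← coeff_slice, slice_phase] at this
    · have := h2 ((0 : Fin d →₀ ℕ).optionElim g) (Finsupp.some_optionElim _ _)
      rwa [← coeff_slice, slice_phase] at this

end Phase

/-! ### The Euler field and closed one-forms. -/

section Euler

variable {k : Type*} [CommRing k] {d : ℕ}

theorem coeff_X_mul {σ : Type*} [DecidableEq σ] (i : σ) (f : MvPowerSeries σ k) (e : σ →₀ ℕ) :
    MvPowerSeries.coeff e (MvPowerSeries.X i * f) =
      if e i = 0 then 0 else MvPowerSeries.coeff (e - Finsupp.single i 1) f := by
  rw [MvPowerSeries.X_def, MvPowerSeries.coeff_monomial_mul]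
  by_cases h : e i = 0
  · simp [h]
  · have : 1 ≤ e i := Nat.one_le_iff_ne_zero.mpr h
    simp [h, this]

theorem coeff_X_mul_pderiv {σ : Type*} (i : σ) (f : MvPowerSeries σ k) (e : σ →₀ ℕ) :
    MvPowerSeries.coeff e (MvPowerSeries.X i * MvPowerSeries.pderiv k i f) =
      e i * MvPowerSeries.coeff e f := by
  classical
  rw [coeff_X_mul]
  split_ifs with h
  · simp [h]
  · have h1 : Finsupp.single i 1 ≤ e := by simpa using Nat.one_le_iff_ne_zero.mpr h
    have h2 : (e - Finsupp.single i 1 : σ →₀ ℕ) i + 1 = e i := by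
      rw [Finsupp.tsub_apply, Finsupp.single_eq_same]; omega
    rw [MvPowerSeries.coeff_pderiv, tsub_add_cancel_of_le h1, ← h2]
    push_cast
    ring

theorem coeff_euler (f : Fun k d) (e : Option (Fin d) →₀ ℕ) :
    MvPowerSeries.coeff e (∑ i, MvPowerSeries.X (some i) * MvPowerSeries.pderiv k (some i) f) =
      (e.some.degree : k) * MvPowerSeries.coeff e f := by
  rw [map_sum, Finset.sum_congr rfl fun i _ => coeff_X_mul_pderiv _ _ _, ← Finset.sum_mul,
    Finsupp.degree_eq_sum]
  simp

theorem coeff_sum_X_mul_eq_zero (u : Fin d → Fun k d) {e : Option (Fin d) →₀ ℕ}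
    (he : e.some = 0) :
    MvPowerSeries.coeff e (∑ i, MvPowerSeries.X (some i) * u i) = 0 := by
  classical
  rw [map_sum]
  refine Finset.sum_eq_zero fun i _ => ?_
  rw [coeff_X_mul, if_pos]
  rw [← Finsupp.some_apply, he, Finsupp.zero_apply]

/-- A formal function valued `1`-form that is closed up to degree `w` and annihilated by the Euler
field vanishes up to degree `w + 1`. -/
theorem mem_funGE_of_closed [NoZeroDivisors k] [CharZero k] {u : Fin d → Fun k d} {w : ℕ}
    (h0 : ∑ i, MvPowerSeries.X (some i) * u i = 0)
    (h : ∀ i j, MvPowerSeries.pderiv k (some i) (u j) - MvPowerSeries.pderiv k (some j) (u i) ∈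
      funGE w) (j : Fin d) : u j ∈ funGE (w + 1) := by
  classical
  have h1 : ∑ i, MvPowerSeries.X (some i) * MvPowerSeries.pderiv k (some i) (u j) + u j ∈
      funGE (w + 1) := by
    -- This gives `u_j = -∑ x_i ∂_j u_i`, so `(E + 1) u_j` is `∑ x_i (∂_i u_j - ∂_j u_i)`.
    have h2 := congrArg (MvPowerSeries.pderiv k (some j)) h0
    simp only [map_sum, map_zero, Derivation.leibniz, MvPowerSeries.pderiv_X, Pi.single_apply,
      Option.some.injEq, smul_eq_mul, mul_ite, mul_one, mul_zero, Finset.sum_add_distrib,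
      Finset.sum_ite_eq', Finset.mem_univ, if_true] at h2
    have h3 : ∑ i, MvPowerSeries.X (some i) * (MvPowerSeries.pderiv k (some i) (u j) -
        MvPowerSeries.pderiv k (some j) (u i)) ∈ funGE (k := k) (d := d) (w + 1) :=
      sum_mem fun i _ => by
        rw [add_comm]
        exact mul_funGE (X_mem_funGE i) (h i j)
    simp only [mul_sub, Finset.sum_sub_distrib] at h3
    convert h3 using 1
    linear_combination h2
  intro e he
  have h2 := h1 e he
  rw [map_add, coeff_euler, ← add_one_mul] at h2
  -- `E + 1` multiplies the coefficient of `ħ^c x^m` by `|m| + 1`, which is nonzero even for `m =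
  -- 0`.
  refine (mul_eq_zero.1 h2).resolve_left ?_
  exact Nat.cast_add_one_ne_zero _

end Euler

/-! ### Contractions for the degree filtration. -/

section FixedPoint

variable {k : Type*} [CommRing k] {d : ℕ}

/-- Iterating from `0`, the `m`-th iterate is correct below degree `n + m`, and formal functions are
complete for the filtration. -/
theorem exists_fixedPoint {Ψ : Fun k d → Fun k d} {n : ℕ} (hmap : ∀ s, s ∈ funGE n → Ψ s ∈ funGE n)
    (hc : ∀ s s' w, s ∈ funGE n → s' ∈ funGE n → n ≤ w → s - s' ∈ funGE w →
      Ψ s - Ψ s' ∈ funGE (w + 1)) : ∃ s ∈ funGE n, Ψ s = s := by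
  obtain ⟨t, ht0, ht⟩ : ∃ t : ℕ → Fun k d, t 0 = 0 ∧ ∀ m, t (m + 1) = Ψ (t m) :=
    ⟨fun m => Ψ^[m] 0, rfl, fun m => Function.iterate_succ_apply' _ _ _⟩
  have hm : ∀ m, t m ∈ funGE n := by
    intro m
    induction m with
    | zero => rw [ht0]; exact zero_mem _
    | succ m ih => rw [ht]; exact hmap _ ih
  have hstep : ∀ m, t (m + 1) - t m ∈ funGE (n + m) := by
    intro m
    induction m with
    | zero => exact sub_mem (hm _) (hm _)
    | succ m ih =>
      rw [ht (m + 1)]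
      nth_rewrite 2 [ht m]
      exact hc _ _ _ (hm _) (hm _) (Nat.le_add_right n m) ih
  have hcauchy : ∀ m r, t (m + r) - t m ∈ funGE (n + m) := by
    intro m r
    induction r with
    | zero => simp
    | succ r ih =>
      have := add_mem (funGE_anti (by omega) (hstep (m + r))) ih
      rwa [sub_add_sub_cancel] at this
  have hcoeff : ∀ m m' e, funDeg e < n + m → m ≤ m' →
      MvPowerSeries.coeff e (t m') = MvPowerSeries.coeff e (t m) := by
    intro m m' e he hmm
    obtain ⟨r, rfl⟩ := Nat.exists_eq_add_of_le hmm
    have := hcauchy m r e he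
    rwa [map_sub, sub_eq_zero] at this
  -- The coefficient at `e` is stable from the iterate `funDeg e + 1` on, since `funDeg e < n +
  -- (funDeg e + 1)`.
  obtain ⟨s, hs⟩ : ∃ s : Fun k d, ∀ e,
      MvPowerSeries.coeff e s = MvPowerSeries.coeff e (t (funDeg e + 1)) :=
    ⟨fun e => MvPowerSeries.coeff e (t (funDeg e + 1)), fun e => rfl⟩
  have hlim : ∀ m, s - t m ∈ funGE (n + m) := by
    intro m e he
    rw [map_sub, hs, sub_eq_zero,
      ← hcoeff (funDeg e + 1) (max (funDeg e + 1) m) e (by omega) (le_max_left _ _),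
      ← hcoeff m (max (funDeg e + 1) m) e he (le_max_right _ _)]
  have hsn : s ∈ funGE n := by simpa [ht0] using hlim 0
  refine ⟨s, hsn, eq_of_forall_funGE fun w => ?_⟩
  have h1 := hc _ _ _ hsn (hm w) (by omega) (hlim w)
  have h2 := hlim (w + 1)
  rw [ht] at h2
  refine funGE_anti (by omega : w ≤ n + w + 1) ?_
  convert sub_mem h1 h2 using 1
  abel

theorem fixedPoint_unique {Ψ : Fun k d → Fun k d} {n : ℕ}
    (hc : ∀ s s' w, s ∈ funGE n → s' ∈ funGE n → n ≤ w → s - s' ∈ funGE w →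
      Ψ s - Ψ s' ∈ funGE (w + 1)) {s s' : Fun k d} (hs : s ∈ funGE n) (hs' : s' ∈ funGE n)
    (h : Ψ s = s) (h' : Ψ s' = s') : s = s' := by
  refine eq_of_forall_funGE fun w => ?_
  have : ∀ w, s - s' ∈ funGE (n + w) := by
    intro w
    induction w with
    | zero => exact sub_mem hs hs'
    | succ w ih =>
      have := hc s s' _ hs hs' (by omega) ih
      rwa [h, h'] at this
  exact funGE_anti (by omega) (this w)

end FixedPoint

/-! ### Existence and uniqueness of the WKB solution. -/

section WKBSolution

variable {k : Type*} [Field k] {d : ℕ}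

/-- The inverse of the Euler operator `∑ x_i ∂_i` on formal functions vanishing at `x = 0`. -/
noncomputable def eulerInv (f : Fun k d) : Fun k d :=
  fun e => (e.some.degree : k)⁻¹ * MvPowerSeries.coeff e f

theorem coeff_eulerInv (f : Fun k d) (e : Option (Fin d) →₀ ℕ) :
    MvPowerSeries.coeff e (eulerInv f) = (e.some.degree : k)⁻¹ * MvPowerSeries.coeff e f := rfl

theorem eulerInv_mem {w : ℕ} {f : Fun k d} (hf : f ∈ funGE w) : eulerInv f ∈ funGE w :=
  fun e he => by rw [coeff_eulerInv, hf e he, mul_zero]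

theorem eulerInv_sub (f g : Fun k d) : eulerInv (f - g) = eulerInv f - eulerInv g := by
  ext e
  simp only [map_sub, coeff_eulerInv, mul_sub]

theorem eulerInv_euler [CharZero k] {f : Fun k d}
    (hf : ∀ e : Option (Fin d) →₀ ℕ, e.some = 0 → MvPowerSeries.coeff e f = 0) :
    eulerInv (∑ i, MvPowerSeries.X (some i) * MvPowerSeries.pderiv k (some i) f) = f := by
  ext e
  rw [coeff_eulerInv, coeff_euler]
  by_cases h : e.some = 0
  · simp [h, hf e h]
  · rw [inv_mul_cancel_left₀]
    rwa [Nat.cast_ne_zero, ne_eq, Finsupp.degree_eq_zero_iff]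

/-- A sum `∑ x_i u_i` has no terms free of `x`, the only ones on which `E` is not invertible. -/
theorem euler_eulerInv [CharZero k] (u : Fin d → Fun k d) :
    ∑ i, MvPowerSeries.X (some i) * MvPowerSeries.pderiv k (some i)
      (eulerInv (∑ i, MvPowerSeries.X (some i) * u i)) = ∑ i, MvPowerSeries.X (some i) * u i := by
  ext e
  rw [coeff_euler, coeff_eulerInv]
  by_cases h : e.some = 0
  · rw [coeff_sum_X_mul_eq_zero u h, mul_zero, mul_zero]
  · rw [mul_inv_cancel_left₀]
    rwa [Nat.cast_ne_zero, ne_eq, Finsupp.degree_eq_zero_iff]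

theorem existsUnique_isWKBSolution [CharZero k] (H : Fin d → DOp k d)
    (hH : ∀ i, ∃ P ∈ DOp.degGE 2, H i = -DOp.p i + P)
    (hcomm : ∀ i j, i ≠ j → ∃ g : Fin d → DOp k d,
      H i * H j - H j * H i = hbarF k d • ∑ l, g l * H l) :
    ∃! S : ℕ → MvPowerSeries (Fin d) k, IsNormalized S ∧ IsWKBSolution H S := by
  choose P hP hHP using hH
  have h23 : (2 : ℕ) ≤ 3 := by norm_num
  have hact : ∀ {s : Fun k d}, s ∈ funGE 2 → ∀ i φ,
      twistAct s (H i) φ = -twist s i φ + twistAct s (P i) φ := by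
    intro s hs i φ
    rw [hHP, twistAct_add hs, ← twistActHom_apply hs, map_neg, twistActHom_apply, twistAct_p hs]
  have htw : ∀ (s : Fun k d) (i : Fin d), twist s i 1 = MvPowerSeries.pderiv k (some i) s := by
    intro s i
    simp [twist_apply, DOp.hpd_apply]
  set Ψ : Fun k d → Fun k d := fun s =>
    eulerInv (∑ i, MvPowerSeries.X (some i) * twistAct s (P i) 1) with hΨ
  have hmap : ∀ s, s ∈ funGE 3 → Ψ s ∈ funGE 3 := fun s hs =>
    eulerInv_mem (sum_mem fun i _ => mul_funGE (v := 1) (w := 2) (X_mem_funGE i)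
      (twistAct_mem (funGE_anti h23 hs) (hP i) (DOp.funGE_zero 1)))
  have hc : ∀ s s' w, s ∈ funGE 3 → s' ∈ funGE 3 → 3 ≤ w → s - s' ∈ funGE w →
      Ψ s - Ψ s' ∈ funGE (w + 1) := by
    intro s s' w hs hs' hw h
    rw [hΨ]
    simp only
    rw [← eulerInv_sub, ← Finset.sum_sub_distrib, add_comm]
    refine eulerInv_mem (sum_mem fun i _ => ?_)
    rw [← mul_sub]
    exact mul_funGE (X_mem_funGE i) (twistAct_one_sub_mem hs hs' hw h (hP i))
  refine existsUnique_of_exists_of_unique ?_ ?_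
  · obtain ⟨s, hs, hfix⟩ := exists_fixedPoint hmap hc
    have hs2 := funGE_anti h23 hs
    refine ⟨fun g => slice g s, ?_, fun i => ?_⟩
    · rw [isNormalized_iff, phase_slice]
      refine ⟨hs, fun e he => ?_⟩
      rw [← hfix, hΨ]
      simp only
      -- Since `0⁻¹ = 0`, `eulerInv` removes all terms free of `x`, so a fixed point is
      -- automatically normalized.
      rw [coeff_eulerInv, he]
      simp
    rw [conj_act_one, phase_slice]
    set u : Fin d → Fun k d := fun i => twistAct s (H i) 1 with hu
    have hu0 : ∑ i, MvPowerSeries.X (some i) * u i = 0 := by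
      have h1 : ∑ i, MvPowerSeries.X (some i) * MvPowerSeries.pderiv k (some i) s =
          ∑ i, MvPowerSeries.X (some i) * twistAct s (P i) 1 := by
        nth_rewrite 1 [← hfix]
        exact euler_eulerInv _
      simp only [hu, hact hs2, htw, mul_add, mul_neg, Finset.sum_add_distrib,
        Finset.sum_neg_distrib, h1, neg_add_cancel]
    have hclosed : ∀ w, (∀ i, u i ∈ funGE w) → ∀ i j,
        MvPowerSeries.pderiv k (some i) (u j) - MvPowerSeries.pderiv k (some j) (u i) ∈
          funGE w := by
      intro w hw i j
      by_cases hij : i = j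
      · subst hij
        rw [sub_self]
        exact zero_mem _
      obtain ⟨g, hg⟩ := hcomm i j hij
      -- Applied to `1`, the relation reads `H_i·u_j - H_j·u_i = ħ ∑ g_l·u_l`.
      have h1 : twistAct s (H i * H j - H j * H i) 1 =
          twistAct s (hbarF k d • ∑ l, g l * H l) 1 := by rw [hg]
      rw [← twistActHom_apply hs2, map_sub, twistActHom_apply, twistActHom_apply,
        twistAct_mul hs2, twistAct_mul hs2, twistAct_smul hs2, ← twistActHom_apply hs2 1 (∑ l, _),
        map_sum] at h1
      simp only [twistActHom_apply, twistAct_mul hs2] at h1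
      change twistAct s (H i) (u j) - twistAct s (H j) (u i) =
        hbarF k d * ∑ l, twistAct s (g l) (u l) at h1
      rw [hact hs2, hact hs2, twist_apply, twist_apply, DOp.hpd_apply, DOp.hpd_apply] at h1
      have h2 : hbarF k d * ∑ l, twistAct s (g l) (u l) ∈ funGE (2 + w) :=
        mul_funGE hbar_mem_funGE (sum_mem fun l _ => by
          simpa using twistAct_mem hs2 (DOp.degGE_zero (g l)) (hw l))
      have h3 : ∀ i j, twistAct s (P i) (u j) ∈ funGE (2 + w) := fun i j =>
        twistAct_mem hs2 (hP i) (hw j)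
      have h4 : ∀ i j, MvPowerSeries.pderiv k (some i) s * u j ∈ funGE (2 + w) := fun i j =>
        mul_funGE (pderiv_funGE i hs) (hw j)
      -- Apart from `ħ(∂_i u_j - ∂_j u_i)`, every term has degree `≥ w + 2`: `P_i` and `∂_i s`
      -- contribute 2, and so does `ħ`. Cancelling `ħ` leaves degree `w`, one better than
      -- differentiating `u` gives.
      refine mem_funGE_of_hbar_mul ?_
      rw [add_comm]
      have h5 := add_mem (sub_mem (h3 i j) (h3 j i)) (sub_mem (h4 j i) (h4 i j))
      convert sub_mem h5 h2 using 1
      linear_combination -h1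
    have hall : ∀ w i, u i ∈ funGE w := by
      intro w
      induction w with
      | zero => exact fun i => DOp.funGE_zero _
      | succ w ih => exact mem_funGE_of_closed hu0 (hclosed w ih)
    exact eq_of_forall_funGE fun w => by simpa using hall w i
  -- A normalized solution has `P_i·1 = ∂_i s`, hence is a fixed point of `Ψ`; the commutator
  -- relations play no role here.
  · have hfp : ∀ S, IsNormalized S ∧ IsWKBSolution H S →
        phase S ∈ funGE 3 ∧ Ψ (phase S) = phase S := by
      rintro S ⟨hn, hw⟩
      obtain ⟨h1, h2⟩ := (isNormalized_iff S).1 hn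
      refine ⟨h1, ?_⟩
      have h3 : ∀ i, twistAct (phase S) (P i) 1 = MvPowerSeries.pderiv k (some i) (phase S) := by
        intro i
        have := hw i
        rw [conj_act_one, hact (funGE_anti h23 h1), htw] at this
        linear_combination this
      change eulerInv (∑ i, MvPowerSeries.X (some i) * twistAct (phase S) (P i) 1) = phase S
      rw [Finset.sum_congr rfl fun i _ => by rw [h3 i]]
      exact eulerInv_euler h2
    intro S S' hS hS'
    obtain ⟨h1, h2⟩ := hfp S hS
    obtain ⟨h1', h2'⟩ := hfp S' hS'
    exact phase_injective (fixedPoint_unique hc h1 h1' h2 h2')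

end WKBSolution

/-! ### Extracting the coefficient of `ħ^g`. -/

section Slices

variable {k : Type*} [CommRing k] {d : ℕ}

theorem slice_mul (g : ℕ) (f h : Fun k d) :
    slice g (f * h) = ∑ gg ∈ Finset.HasAntidiagonal.antidiagonal g,
      slice gg.1 f * slice gg.2 h := by
  classical
  ext m
  rw [map_sum, coeff_slice, MvPowerSeries.coeff_mul]
  simp only [MvPowerSeries.coeff_mul, coeff_slice]
  rw [← Finset.sum_product']
  have hsome : ∀ a b : Option (Fin d) →₀ ℕ, (a + b).some = a.some + b.some := fun a b => by
    ext i; simp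
  refine Finset.sum_bij' (fun x _ => ((x.1 none, x.2 none), (x.1.some, x.2.some)))
    (fun y _ => (y.2.1.optionElim y.1.1, y.2.2.optionElim y.1.2)) ?_ ?_ ?_ ?_ ?_
  · rintro ⟨a, b⟩ hx
    rw [Finset.HasAntidiagonal.mem_antidiagonal] at hx
    simp only [Finset.mem_product, Finset.HasAntidiagonal.mem_antidiagonal]
    change a + b = _ at hx
    refine ⟨?_, ?_⟩
    · rw [← Finsupp.add_apply, hx, Finsupp.optionElim_apply_none]
    · rw [← hsome, hx, Finsupp.some_optionElim]
  · rintro ⟨⟨a, b⟩, ⟨u, v⟩⟩ hy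
    simp only [Finset.mem_product, Finset.HasAntidiagonal.mem_antidiagonal] at hy ⊢
    obtain ⟨h1, h2⟩ := hy
    ext o
    rcases o with _ | o
    · simp [Finsupp.optionElim_apply_eq_elim, h1]
    · simp [Finsupp.optionElim_apply_eq_elim, ← h2]
  · rintro ⟨a, b⟩ _
    simp only [Finsupp.optionElim_some]
  · rintro ⟨⟨a, b⟩, ⟨u, v⟩⟩ _
    simp only [Finsupp.some_optionElim, Finsupp.optionElim_apply_none]
  · rintro ⟨a, b⟩ _
    simp only [Finsupp.optionElim_some]

theorem slice_pderiv (g : ℕ) (i : Fin d) (f : Fun k d) :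
    slice g (MvPowerSeries.pderiv k (some i) f) = MvPowerSeries.pderiv k i (slice g f) := by
  ext m
  rw [coeff_slice, MvPowerSeries.coeff_pderiv, MvPowerSeries.coeff_pderiv, coeff_slice,
    Finsupp.optionElim_apply_some]
  congr 2
  congr 1
  ext o
  rcases o with _ | o <;>
  simp [Finsupp.optionElim_apply_eq_elim, Finsupp.single_apply]

theorem slice_X_mul (g : ℕ) (i : Fin d) (f : Fun k d) :
    slice g (MvPowerSeries.X (some i) * f) = MvPowerSeries.X i * slice g f := by
  classical
  ext m
  rw [coeff_slice, coeff_X_mul, coeff_X_mul, coeff_slice, Finsupp.optionElim_apply_some]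
  split_ifs
  · rfl
  congr 2
  ext o
  rcases o with _ | o <;>
  simp [Finsupp.optionElim_apply_eq_elim, Finsupp.single_apply]

theorem slice_hbar_mul (g : ℕ) (f : Fun k d) :
    slice g (hbarF k d * f) = if g = 0 then 0 else slice (g - 1) f := by
  classical
  ext m
  rw [coeff_slice, coeff_X_mul, Finsupp.optionElim_apply_none]
  split_ifs
  · simp
  rw [coeff_slice]
  congr 2
  ext o
  rcases o with _ | o <;>
  simp [Finsupp.optionElim_apply_eq_elim]

theorem slice_one (g : ℕ) : slice g (1 : Fun k d) = if g = 0 then 1 else 0 := by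
  classical
  ext m
  rw [coeff_slice, MvPowerSeries.coeff_one]
  have : (m.optionElim g : Option (Fin d) →₀ ℕ) = 0 ↔ g = 0 ∧ m = 0 := by
    rw [← not_iff_not, ← ne_eq, Finsupp.optionElim_ne_zero_iff]
    tauto
  simp only [this]
  by_cases hg : g = 0
  · simp [hg, MvPowerSeries.coeff_one]
  · simp [hg]

end Slices

/-! ### Derivatives at the origin and Leibniz rules over subsets of indices. -/

section Taylor

variable {k : Type*} [CommRing k] {d : ℕ}

/-- The value at `0` of the derivative `∂^m f`. -/
noncomputable def taylorCoeff (m : Fin d →₀ ℕ) : MvPowerSeries (Fin d) k →ₗ[k] k :=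
  ((∏ i, (m i).factorial : ℕ) : k) • MvPowerSeries.coeff m

theorem taylorCoeff_apply (m : Fin d →₀ ℕ) (f : MvPowerSeries (Fin d) k) :
    taylorCoeff m f = ((∏ i, (m i).factorial : ℕ) : k) * MvPowerSeries.coeff m f := rfl

theorem taylorCoeff_zero (f : MvPowerSeries (Fin d) k) :
    taylorCoeff 0 f = MvPowerSeries.constantCoeff f := by
  simp [taylorCoeff_apply]

/-- The factorials in `taylorCoeff` absorb the factor `m_i + 1` produced by differentiation. -/
theorem taylorCoeff_pderiv (m : Fin d →₀ ℕ) (i : Fin d) (f : MvPowerSeries (Fin d) k) :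
    taylorCoeff m (MvPowerSeries.pderiv k i f) = taylorCoeff (m + Finsupp.single i 1) f := by
  classical
  rw [taylorCoeff_apply, taylorCoeff_apply, MvPowerSeries.coeff_pderiv]
  have h : ∏ j, ((m + Finsupp.single i 1 : Fin d →₀ ℕ) j).factorial = (m i + 1) * ∏ j, (m j).factorial := by
    rw [← Finset.mul_prod_erase _ _ (Finset.mem_univ i),
      ← Finset.mul_prod_erase _ (fun j => (m j).factorial) (Finset.mem_univ i), ← mul_assoc,
      ← Nat.factorial_succ]
    congr 1
    · simp
    · refine Finset.prod_congr rfl fun j hj => ?_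
      simp [Finset.ne_of_mem_erase hj]
  rw [h]
  push_cast
  ring

/-- The exponent of the monomial `∏_{r ∈ J} x_{i_r}`. -/
noncomputable def idxExp {ι : Type*} (idx : ι → Fin d) (J : Finset ι) : Fin d →₀ ℕ :=
  ∑ r ∈ J, Finsupp.single (idx r) 1

theorem degree_idxExp {ι : Type*} (idx : ι → Fin d) (J : Finset ι) :
    (idxExp idx J).degree = J.card := by
  simp [idxExp]

theorem taylor_eq (f : MvPowerSeries (Fin d) k) {n : ℕ} (idx : Fin n → Fin d) :
    taylor f idx = taylorCoeff (idxExp idx Finset.univ) f := by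
  have key : ∀ (L : List (Fin d)) (m : Fin d →₀ ℕ),
      taylorCoeff m (L.foldr (fun i h => MvPowerSeries.pderiv k i h) f) =
        taylorCoeff (m + (L.map fun i => Finsupp.single i 1).sum) f := by
    intro L
    induction L with
    | nil => simp
    | cons i L ih =>
      intro m
      rw [List.foldr_cons, taylorCoeff_pderiv, ih, List.map_cons, List.sum_cons, add_assoc]
  rw [taylor, ← taylorCoeff_zero, key, zero_add, List.map_ofFn, List.sum_ofFn]
  rfl

theorem idxExp_vecCons (i : Fin d) {n : ℕ} (idx : Fin n → Fin d) :
    idxExp (Matrix.vecCons i idx) Finset.univ = idxExp idx Finset.univ + Finsupp.single i 1 := by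
  rw [idxExp, Fin.sum_univ_succ, add_comm]
  simp [idxExp]

/-- The exponent is an unordered sum over `J`. This is why the recursion holds for every choice of
enumerations. -/
theorem idxExp_sub (en : Enumeration) {m : ℕ} (idx : Fin m → Fin d) (J : Finset (Fin m)) :
    idxExp (en.sub idx J) Finset.univ = idxExp idx J := by
  rw [idxExp, idxExp, ← Finset.sum_coe_sort J]
  exact (en m J).sum_comp fun r => Finsupp.single (idx r) 1

theorem taylor_vecCons (f : MvPowerSeries (Fin d) k) (i : Fin d) {n : ℕ} (idx : Fin n → Fin d) :
    taylor f (Matrix.vecCons i idx) =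
      taylorCoeff (idxExp idx Finset.univ) (MvPowerSeries.pderiv k i f) := by
  rw [taylor_eq, idxExp_vecCons, taylorCoeff_pderiv]

theorem taylor_vecCons_sub (en : Enumeration) (f : MvPowerSeries (Fin d) k) (i : Fin d) {m : ℕ}
    (idx : Fin m → Fin d) (J : Finset (Fin m)) :
    taylor f (Matrix.vecCons i (en.sub idx J)) =
      taylorCoeff (idxExp idx J) (MvPowerSeries.pderiv k i f) := by
  rw [taylor_vecCons, idxExp_sub]

theorem taylor_comp_perm (f : MvPowerSeries (Fin d) k) {n : ℕ} (σ : Equiv.Perm (Fin n))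
    (idx : Fin n → Fin d) : taylor f (idx ∘ σ) = taylor f idx := by
  rw [taylor_eq, taylor_eq]
  congr 2
  exact Equiv.sum_comp σ fun r => Finsupp.single (idx r) 1

variable {ι : Type*} [DecidableEq ι]

theorem taylorCoeff_insert (idx : ι → Fin d) {a : ι} {K : Finset ι} (ha : a ∉ K)
    (f : MvPowerSeries (Fin d) k) :
    taylorCoeff (idxExp idx (insert a K)) f =
      taylorCoeff (idxExp idx K) (MvPowerSeries.pderiv k (idx a) f) := by
  rw [taylorCoeff_pderiv, idxExp, Finset.sum_insert ha, add_comm]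
  rfl

/-- The Leibniz rule for iterated derivatives at `0`. -/
theorem taylorCoeff_mul (idx : ι → Fin d) (K : Finset ι) (f h : MvPowerSeries (Fin d) k) :
    taylorCoeff (idxExp idx K) (f * h) =
      ∑ J ∈ K.powerset, taylorCoeff (idxExp idx J) f * taylorCoeff (idxExp idx (K \ J)) h := by
  induction K using Finset.induction_on generalizing f h with
  | empty => simp [idxExp, taylorCoeff_zero]
  | insert a K ha ih =>
    -- Subsets of `insert a K` are split by whether they contain `a`, that is, whether the
    -- derivative labelled `a` falls on `f` or on `h`.
    rw [taylorCoeff_insert _ ha, Derivation.leibniz, smul_eq_mul, smul_eq_mul, map_add, ih,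
      mul_comm h, ih, Finset.sum_powerset_insert ha]
    refine congrArg₂ (· + ·) ?_ ?_
    · refine Finset.sum_congr rfl fun J hJ => ?_
      have haJ : a ∉ J := fun h => ha (Finset.mem_powerset.1 hJ h)
      rw [Finset.insert_sdiff_of_notMem _ haJ, taylorCoeff_insert _ (by simp [ha])]
    · refine Finset.sum_congr rfl fun J hJ => ?_
      have haJ : a ∉ J := fun h => ha (Finset.mem_powerset.1 hJ h)
      rw [taylorCoeff_insert _ haJ, Finset.insert_sdiff_insert, Finset.sdiff_insert_of_notMem ha]

/-- At the origin a term survives only if exactly one derivative, labelled `α`, falls on `x_j`. -/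
theorem taylorCoeff_X_mul (idx : ι → Fin d) (K : Finset ι) (j : Fin d)
    (h : MvPowerSeries (Fin d) k) :
    taylorCoeff (idxExp idx K) (MvPowerSeries.X j * h) =
      ∑ α ∈ K, if idx α = j then taylorCoeff (idxExp idx (K.erase α)) h else 0 := by
  classical
  induction K using Finset.induction_on generalizing h with
  | empty => simp [idxExp, taylorCoeff_zero]
  | insert a K ha ih =>
    rw [taylorCoeff_insert _ ha, Derivation.leibniz, smul_eq_mul, smul_eq_mul, map_add, ih,
      Finset.sum_insert ha, Finset.erase_insert ha, add_comm]
    refine congrArg₂ (· + ·) ?_ ?_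
    · rw [MvPowerSeries.pderiv_X, Pi.single_apply]
      by_cases hj : idx a = j
      · simp [hj]
      · simp [hj, Ne.symm hj]
    · refine Finset.sum_congr rfl fun α hα => ?_
      have hne : α ≠ a := fun h => ha (h ▸ hα)
      rw [Finset.erase_insert_of_ne hne.symm, taylorCoeff_insert _ (by simp [ha])]

theorem taylorCoeff_one (idx : ι → Fin d) (K : Finset ι) :
    taylorCoeff (idxExp idx K) (1 : MvPowerSeries (Fin d) k) = if K = ∅ then 1 else 0 := by
  classical
  have h : idxExp idx K = 0 ↔ K = ∅ := by
    rw [← Finsupp.degree_eq_zero_iff, degree_idxExp, Finset.card_eq_zero]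
  rw [taylorCoeff_apply, MvPowerSeries.coeff_one]
  simp only [h]
  split_ifs with hK
  · simp [h.2 hK]
  · simp

end Taylor

/-! ### Quantum Airy structures and the topological recursion. -/

section Recursion

variable {k : Type*} [CommRing k] {d : ℕ}

theorem airyH_eq (a b c : Fin d → Fin d → Fin d → k) (ε : Fin d → k) (i : Fin d) :
    ∃ P ∈ DOp.degGE 2, airyH a b c ε i = -DOp.p i + P := by
  have hone : (1 : DOp k d) ∈ DOp.degGE 0 := DOp.degGE_zero 1
  have hp : ∀ l : Fin d, (DOp.p l : DOp k d) ∈ DOp.degGE 1 := fun l => by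
    rw [p_eq_nabla]
    exact DOp.nabla_degGE l hone
  have hx : ∀ (j : Fin d) {w : ℕ} {f : DOp k d}, f ∈ DOp.degGE w →
      DOp.x j * f ∈ DOp.degGE (1 + w) := fun j w f hf => by
    rw [DOp.x, ofFun_mul]
    exact DOp.smul_degGE (X_mem_funGE j) hf
  refine ⟨_, ?_, by rw [airyH, add_assoc, add_assoc, add_assoc]⟩
  refine add_mem (sum_mem fun j _ => sum_mem fun l _ => DOp.smul_degGE' _ ?_)
    (add_mem (sum_mem fun j _ => sum_mem fun l _ => DOp.smul_degGE' _ ?_)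
      (add_mem (sum_mem fun j _ => sum_mem fun l _ => DOp.smul_degGE' _ ?_) ?_))
  · rw [← mul_one (DOp.x l)]
    exact hx j (hx l hone)
  · exact hx j (hp l)
  · rw [p_mul]
    exact DOp.nabla_degGE j (hp l)
  · rw [mul_comm, mul_smul]
    exact DOp.smul_degGE' _ (DOp.smul_degGE hbar_mem_funGE hone)

/-- The `C`-terms come from `(ħ∂_j + ∂_j s)(∂_l s)`: one part is linear in `s` and carries an `ħ`,
the other is quadratic. The factors `1` are kept so that `slice_X_mul` and `slice_hbar_mul` apply
uniformly. -/
theorem twistAct_airyH {s : Fun k d} (hs : s ∈ funGE 2) (a b c : Fin d → Fin d → Fin d → k)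
    (ε : Fin d → k) (i : Fin d) :
    twistAct s (airyH a b c ε i) 1 = -MvPowerSeries.pderiv k (some i) s
      + ∑ j, ∑ l, a i j l • (MvPowerSeries.X (some j) * (MvPowerSeries.X (some l) * 1))
      + ∑ j, ∑ l, (2 * b i j l) • (MvPowerSeries.X (some j) * MvPowerSeries.pderiv k (some l) s)
      + ∑ j, ∑ l, c i j l • (hbarF k d *
          MvPowerSeries.pderiv k (some j) (MvPowerSeries.pderiv k (some l) s) +
          MvPowerSeries.pderiv k (some j) s * MvPowerSeries.pderiv k (some l) s)
      + ε i • (hbarF k d * 1) := by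
  have htw : ∀ i : Fin d, twist s i 1 = MvPowerSeries.pderiv k (some i) s := by
    intro i
    simp [twist_apply, DOp.hpd_apply]
  have hx : ∀ (j : Fin d) (f : DOp k d),
      twistAct s (DOp.x j * f) 1 = MvPowerSeries.X (some j) * twistAct s f 1 := fun j f => by
    rw [DOp.x, ofFun_mul, twistAct_smul hs]
  have hx1 : ∀ j : Fin d, twistAct s (DOp.x j) 1 = MvPowerSeries.X (some j) * 1 := fun j => by
    rw [← mul_one (DOp.x j), hx, twistAct_one]
  have hp : ∀ j : Fin d, twistAct s (DOp.p j) 1 = MvPowerSeries.pderiv k (some j) s := fun j => by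
    rw [twistAct_p hs, htw]
  have hpp : ∀ j l : Fin d, twistAct s (DOp.p j * DOp.p l) 1 = hbarF k d *
      MvPowerSeries.pderiv k (some j) (MvPowerSeries.pderiv k (some l) s) +
      MvPowerSeries.pderiv k (some j) s * MvPowerSeries.pderiv k (some l) s := fun j l => by
    rw [twistAct_mul hs, hp, twistAct_p hs, twist_apply, DOp.hpd_apply]
  rw [← twistActHom_apply hs, airyH]
  simp only [map_add, map_neg, map_sum, twistActHom_apply, twistAct_smul hs, hx, hx1, hp, hpp,
    twistAct_one, MvPowerSeries.smul_eq_C_mul]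
  ring

theorem pderiv_eq_of_isWKBSolution (Q : QuantumAiry k d) {S : ℕ → MvPowerSeries (Fin d) k}
    (hn : IsNormalized S) (hS : IsWKBSolution Q.H S) (g : ℕ) (i : Fin d) :
    MvPowerSeries.pderiv k i (S g) =
      (if g = 0 then ∑ j, ∑ l, Q.a i j l • (MvPowerSeries.X j * (MvPowerSeries.X l * 1)) else 0)
      + ∑ j, ∑ l, (2 * Q.b i j l) • (MvPowerSeries.X j * MvPowerSeries.pderiv k l (S g))
      + ∑ j, ∑ l, Q.c i j l • ((if g = 0 then 0 else
            MvPowerSeries.pderiv k j (MvPowerSeries.pderiv k l (S (g - 1)))) +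
          ∑ gg ∈ Finset.HasAntidiagonal.antidiagonal g,
            MvPowerSeries.pderiv k j (S gg.1) * MvPowerSeries.pderiv k l (S gg.2))
      + (if g = 1 then Q.ε i • 1 else 0) := by
  have h := hS i
  rw [conj_act_one, QuantumAiry.H, twistAct_airyH
    (funGE_anti (by norm_num) ((isNormalized_iff S).1 hn).1)] at h
  have h1 := congrArg (slice g) h
  simp only [map_add, map_neg, map_sum, map_smul, slice_X_mul, slice_hbar_mul, slice_one,
    map_zero] at h1
  simp only [slice_mul, slice_pderiv, slice_phase] at h1
  rw [add_assoc, add_assoc, add_assoc, neg_add_eq_zero] at h1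
  rw [h1]
  rcases g with _ | _ | g
  · simp [add_assoc]
  · simp [add_assoc]
  · simp [add_assoc]

theorem taylor_vecCons_vecCons (f : MvPowerSeries (Fin d) k) (j l : Fin d) {n : ℕ}
    (idx : Fin n → Fin d) :
    taylor f (Matrix.vecCons j (Matrix.vecCons l idx)) = taylorCoeff (idxExp idx Finset.univ)
      (MvPowerSeries.pderiv k j (MvPowerSeries.pderiv k l f)) := by
  rw [taylor_vecCons, idxExp_vecCons, ← taylorCoeff_pderiv, pderiv_comm]

/-- Differentiating the equation for `S_g` at `0`: in the `B`-terms `x_j` absorbs one index `α`, and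
products split over `J` and its complement. The identity holds for all `g` and `m`; the extra `A`
and `ε` terms supply the initial values and vanish in the range of the recursion. -/
theorem taylor_recursion (Q : QuantumAiry k d) {S : ℕ → MvPowerSeries (Fin d) k}
    (hn : IsNormalized S) (hS : IsWKBSolution Q.H S) (en : Enumeration) (g m : ℕ) (i : Fin d)
    (idx : Fin m → Fin d) :
    taylor (S g) (Matrix.vecCons i idx) =
      (if g = 0 then ∑ j, ∑ l, Q.a i j l * taylorCoeff (idxExp idx Finset.univ)
        (MvPowerSeries.X j * (MvPowerSeries.X l * 1)) else 0)
      + (2 * ∑ α : Fin m, ∑ l, Q.b i (idx α) l *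
            taylor (S g) (Matrix.vecCons l (en.sub idx (Finset.univ.erase α)))
        + ∑ gg ∈ Finset.HasAntidiagonal.antidiagonal g, ∑ J : Finset (Fin m), ∑ j, ∑ l, Q.c i j l *
            taylor (S gg.1) (Matrix.vecCons j (en.sub idx J)) *
            taylor (S gg.2) (Matrix.vecCons l (en.sub idx Jᶜ))
        + if g = 0 then 0 else ∑ j, ∑ l, Q.c i j l *
            taylor (S (g - 1)) (Matrix.vecCons j (Matrix.vecCons l idx)))
      + (if g = 1 then Q.ε i * taylorCoeff (idxExp idx Finset.univ) 1 else 0) := by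
  have hb : ∑ j, ∑ l, (2 * Q.b i j l) * taylorCoeff (idxExp idx Finset.univ)
      (MvPowerSeries.X j * MvPowerSeries.pderiv k l (S g)) =
      2 * ∑ α : Fin m, ∑ l, Q.b i (idx α) l *
            taylor (S g) (Matrix.vecCons l (en.sub idx (Finset.univ.erase α))) := by
    simp only [taylorCoeff_X_mul, taylor_vecCons_sub, Finset.mul_sum]
    rw [Finset.sum_comm, Finset.sum_comm (γ := Fin m)]
    refine Finset.sum_congr rfl fun l _ => ?_
    rw [Finset.sum_comm]
    refine Finset.sum_congr rfl fun α _ => ?_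
    simp [mul_assoc]
  have hc : ∑ j, ∑ l, Q.c i j l * ∑ gg ∈ Finset.HasAntidiagonal.antidiagonal g,
      taylorCoeff (idxExp idx Finset.univ)
        (MvPowerSeries.pderiv k j (S gg.1) * MvPowerSeries.pderiv k l (S gg.2)) =
      ∑ gg ∈ Finset.HasAntidiagonal.antidiagonal g, ∑ J : Finset (Fin m), ∑ j, ∑ l, Q.c i j l *
            taylor (S gg.1) (Matrix.vecCons j (en.sub idx J)) *
            taylor (S gg.2) (Matrix.vecCons l (en.sub idx Jᶜ)) := by
    simp only [taylorCoeff_mul, taylor_vecCons_sub, Finset.mul_sum, Finset.powerset_univ,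
      ← Finset.compl_eq_univ_sdiff, mul_assoc]
    rw [Finset.sum_congr rfl fun j _ => Finset.sum_comm, Finset.sum_comm]
    refine Finset.sum_congr rfl fun gg _ => ?_
    rw [Finset.sum_congr rfl fun j _ => Finset.sum_comm, Finset.sum_comm]
  have h := congrArg (taylorCoeff (idxExp idx Finset.univ))
    (pderiv_eq_of_isWKBSolution Q hn hS g i)
  rw [← taylor_vecCons] at h
  rw [h, ← hb, ← hc]
  simp only [map_add, map_sum, map_smul, smul_eq_mul, mul_add, Finset.sum_add_distrib,
    apply_ite (taylorCoeff (idxExp idx Finset.univ)), map_zero, taylor_vecCons_vecCons]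
  by_cases hg : g = 0
  · simp only [hg, if_true, mul_zero, Finset.sum_const_zero]
    ring
  · simp only [hg, if_false]
    ring

theorem taylor_eq_zero_of_degree {f : MvPowerSeries (Fin d) k} {n : ℕ} (idx : Fin n → Fin d)
    (h : ∀ m : Fin d →₀ ℕ, m.degree = n → MvPowerSeries.coeff m f = 0) : taylor f idx = 0 := by
  rw [taylor_eq, taylorCoeff_apply, h _ (by rw [degree_idxExp, Finset.card_univ, Fintype.card_fin]),
    mul_zero]

theorem taylorCoeff_X_mul_X (idx : Fin 2 → Fin d) (j l : Fin d) :
    taylorCoeff (k := k) (idxExp idx Finset.univ) (MvPowerSeries.X j * (MvPowerSeries.X l * 1)) =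
      (if idx 0 = j then if idx 1 = l then 1 else 0 else 0) +
      (if idx 1 = j then if idx 0 = l then 1 else 0 else 0) := by
  have h0 : (Finset.univ.erase 0 : Finset (Fin 2)) = {1} := by decide
  have h1 : (Finset.univ.erase 1 : Finset (Fin 2)) = {0} := by decide
  simp [-mul_one, taylorCoeff_X_mul, taylorCoeff_one, h0, h1]

theorem taylorCoeff_X_mul_X_eq_zero {m : ℕ} (hm : 3 ≤ m) (idx : Fin m → Fin d) (j l : Fin d) :
    taylorCoeff (k := k) (idxExp idx Finset.univ)
      (MvPowerSeries.X j * (MvPowerSeries.X l * 1)) = 0 := by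
  rw [taylorCoeff_X_mul]
  refine Finset.sum_eq_zero fun α _ => ?_
  rw [taylorCoeff_X_mul, ite_eq_right_iff]
  refine fun _ => Finset.sum_eq_zero fun β hβ => ?_
  rw [taylorCoeff_one, ite_eq_right_iff]
  refine fun _ => if_neg fun h => ?_
  have h1 := Finset.card_erase_of_mem hβ
  rw [h, Finset.card_erase_of_mem (Finset.mem_univ α), Finset.card_univ, Fintype.card_fin,
    Finset.card_empty] at h1
  omega

theorem isATR_taylor (Q : QuantumAiry k d) {S : ℕ → MvPowerSeries (Fin d) k}
    (hn : IsNormalized S) (hS : IsWKBSolution Q.H S) (en : Enumeration) :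
    IsATR Q en fun g _ idx => taylor (S g) idx := by
  have hle : ∀ n ≤ 2, ∀ idx : Fin n → Fin d, taylor (S 0) idx = 0 := fun n hn2 idx =>
    taylor_eq_zero_of_degree idx fun m hm => hn.1 m (by omega)
  refine ⟨hle, ?_, ?_, ?_, ?_⟩
  · intro g idx
    refine taylor_eq_zero_of_degree idx fun m hm => ?_
    rw [(Finsupp.degree_eq_zero_iff m).1 hm]
    exact hn.2 g
  · intro idx
    have e : idx = Matrix.vecCons (idx 0) (fun r : Fin 2 => idx r.succ) := by
      funext r
      refine Fin.cases rfl (fun r => rfl) r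
    -- The `B`-terms contain `S_{0,2} = 0`, and in each `C`-term one factor is `S_{0,n}` with `n ≤
    -- 2`. What remains is `a_{ijl} + a_{ilj}`.
    have h := taylor_recursion Q hn hS en 0 2 (idx 0) (fun r : Fin 2 => idx r.succ)
    rw [← e] at h
    have hb : ∀ (α : Fin 2) (l : Fin d), taylor (S 0) (Matrix.vecCons l
        (en.sub (fun r : Fin 2 => idx r.succ) (Finset.univ.erase α))) = 0 := fun α l =>
      hle _ (by rw [Finset.card_erase_of_mem (Finset.mem_univ α)]; simp) _
    have hc : ∀ (J : Finset (Fin 2)) (j l : Fin d),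
        taylor (S 0) (Matrix.vecCons j (en.sub (fun r : Fin 2 => idx r.succ) J)) *
        taylor (S 0) (Matrix.vecCons l (en.sub (fun r : Fin 2 => idx r.succ) Jᶜ)) = 0 := by
      intro J j l
      have hJ := Finset.card_add_card_compl J
      rw [Fintype.card_fin] at hJ
      by_cases h1 : J.card ≤ 1
      · rw [hle _ (by omega), zero_mul]
      · rw [hle (Jᶜ.card + 1) (by omega), mul_zero]
    simp only [taylorCoeff_X_mul_X] at h
    simp only [hb, hc, mul_assoc, Finset.Nat.antidiagonal_zero, Finset.sum_singleton, mul_zero,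
      Finset.sum_const_zero, if_true, zero_ne_one, if_false, add_zero, mul_add,
       mul_ite, mul_one, Finset.sum_add_distrib, Finset.sum_ite_irrel, Finset.sum_ite_eq,
      Finset.mem_univ] at h
    refine h.trans ?_
    change Q.a (idx 0) (idx 1) (idx 2) + Q.a (idx 0) (idx 2) (idx 1) = _
    rw [Q.a_symm (idx 0) (idx 2) (idx 1)]
    ring
  · intro idx
    have e : idx = Matrix.vecCons (idx 0) (fun r : Fin 0 => r.elim0) := by
      funext r
      refine Fin.cases rfl (fun r => r.elim0) r
    have h := taylor_recursion Q hn hS en 1 0 (idx 0) (fun r : Fin 0 => r.elim0)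
    rw [← e] at h
    have hc : ∀ (gg : ℕ × ℕ) (_ : gg ∈ Finset.HasAntidiagonal.antidiagonal 1)
        (J : Finset (Fin 0)) (j l : Fin d),
        taylor (S gg.1) (Matrix.vecCons j (en.sub (fun r : Fin 0 => r.elim0) J)) *
        taylor (S gg.2) (Matrix.vecCons l (en.sub (fun r : Fin 0 => r.elim0) Jᶜ)) = 0 := by
      rintro ⟨g₁, g₂⟩ hg J j l
      rw [Finset.HasAntidiagonal.mem_antidiagonal] at hg
      change g₁ + g₂ = 1 at hg
      have hJ := Finset.card_add_card_compl J
      rw [Fintype.card_fin] at hJ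
      change taylor (S g₁) _ * taylor (S g₂) _ = 0
      -- As `g₁ + g₂ = 1`, one factor has genus `0`, and with a single index it vanishes.
      rcases Nat.eq_zero_or_pos g₁ with rfl | h1
      · rw [hle _ (by omega), zero_mul]
      · obtain rfl : g₂ = 0 := by omega
        rw [hle (Jᶜ.card + 1) (by omega), mul_zero]
    have hc' : (∑ gg ∈ Finset.HasAntidiagonal.antidiagonal 1, ∑ J : Finset (Fin 0), ∑ j, ∑ l,
        Q.c (idx 0) j l *
            taylor (S gg.1) (Matrix.vecCons j (en.sub (fun r : Fin 0 => r.elim0) J)) *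
            taylor (S gg.2) (Matrix.vecCons l (en.sub (fun r : Fin 0 => r.elim0) Jᶜ))) = 0 := by
      refine Finset.sum_eq_zero fun gg hg => Finset.sum_eq_zero fun J _ =>
        Finset.sum_eq_zero fun j _ => Finset.sum_eq_zero fun l _ => ?_
      rw [mul_assoc, hc gg hg, mul_zero]
    have hd : ∀ j l : Fin d, taylor (S 0)
        (Matrix.vecCons j (Matrix.vecCons l (fun r : Fin 0 => r.elim0))) = 0 := fun j l =>
      hle 2 le_rfl _
    rw [hc'] at h
    simp only [taylorCoeff_one, Nat.sub_self, hd] at h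
    simpa using h
  · intro g m hgm i idx
    have h := taylor_recursion Q hn hS en g m i idx
    refine h.trans ?_
    have h1 : (if g = 0 then ∑ j, ∑ l, Q.a i j l * taylorCoeff (idxExp idx Finset.univ)
        (MvPowerSeries.X j * (MvPowerSeries.X l * 1)) else 0) = 0 := by
      rw [ite_eq_right_iff]
      intro hg
      refine Finset.sum_eq_zero fun j _ => Finset.sum_eq_zero fun l _ => ?_
      rw [taylorCoeff_X_mul_X_eq_zero (by omega), mul_zero]
    have h2 : (if g = 1 then Q.ε i * taylorCoeff (idxExp idx Finset.univ) 1 else 0) = 0 := by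
      rw [ite_eq_right_iff]
      intro hg
      rw [taylorCoeff_one, if_neg, mul_zero]
      have : NeZero m := ⟨by omega⟩
      exact Finset.univ_nonempty.ne_empty
    rw [h1, h2, zero_add, add_zero]

/-- Induction on `2g + n`: the `B`-terms and the genus-lowering term have weight exactly one less.
In the quadratic terms the two weights add up to one more than the weight of the left side. -/
theorem IsATR.unique {Q : QuantumAiry k d} {en : Enumeration}
    {T T' : ∀ (_ n : ℕ), (Fin n → Fin d) → k} (hT : IsATR Q en T) (hT' : IsATR Q en T') :
    T = T' := by
  have hsmall : ∀ {U : ∀ (_ n : ℕ), (Fin n → Fin d) → k}, IsATR Q en U → ∀ g n idx,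
      2 * g + n ≤ 2 → U g n idx = 0 := by
    intro U hU g n idx h
    rcases Nat.eq_zero_or_pos g with rfl | hg
    · exact hU.zero_of_le n (by omega) idx
    · obtain rfl : n = 0 := by omega
      exact hU.zero_right g idx
  have key : ∀ N g n, 2 * g + n < N → ∀ idx, T g n idx = T' g n idx := by
    intro N
    induction N with
    | zero => intro g n h; omega
    | succ N ih =>
      intro g n h idx
      rcases n with _ | m
      · rw [hT.zero_right, hT'.zero_right]
      by_cases hstep : (g = 0 ∧ 4 ≤ m + 1) ∨ (g = 1 ∧ 2 ≤ m + 1) ∨ 2 ≤ g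
      · obtain ⟨i, idx, rfl⟩ : ∃ i idx', idx = Matrix.vecCons i idx' :=
          ⟨idx 0, Fin.tail idx, (Fin.cons_self_tail idx).symm⟩
        rw [hT.step g m hstep, hT'.step g m hstep]
        refine congrArg₂ (· + ·) (congrArg₂ (· + ·) ?_ ?_) ?_
        · congr 1
          refine Finset.sum_congr rfl fun α _ => Finset.sum_congr rfl fun l _ => ?_
          rw [ih]
          rw [Finset.card_erase_of_mem (Finset.mem_univ α), Finset.card_univ, Fintype.card_fin]
          have := α.isLt
          omega
        · refine Finset.sum_congr rfl fun gg hgg => Finset.sum_congr rfl fun J _ =>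
            Finset.sum_congr rfl fun j _ => Finset.sum_congr rfl fun l _ => ?_
          rw [Finset.HasAntidiagonal.mem_antidiagonal] at hgg
          have hJ := Finset.card_add_card_compl J
          rw [Fintype.card_fin] at hJ
          -- The two weights sum to at most `N + 1`. If one is at least `N`, the other is at most 1,
          -- so that factor vanishes for both families and the product needs no comparison.
          by_cases h1 : 2 * gg.1 + (J.card + 1) < N
          · by_cases h2 : 2 * gg.2 + (Jᶜ.card + 1) < N
            · rw [ih _ _ h1, ih _ _ h2]
            · rw [hsmall hT gg.1 (J.card + 1) _ (by omega),
                hsmall hT' gg.1 (J.card + 1) _ (by omega)]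
              simp
          · rw [hsmall hT gg.2 (Jᶜ.card + 1) _ (by omega),
              hsmall hT' gg.2 (Jᶜ.card + 1) _ (by omega)]
            simp
        · split_ifs with hg
          · rfl
          refine Finset.sum_congr rfl fun j _ => Finset.sum_congr rfl fun l _ => ?_
          rw [ih _ _ (by omega)]
      -- Outside the range of the recursion only the vanishing cases and the initial values `(0,3)`
      -- and `(1,1)` remain.
      · by_cases hle : 2 * g + (m + 1) ≤ 2
        · rw [hsmall hT _ _ _ hle, hsmall hT' _ _ _ hle]
        · rcases Nat.eq_zero_or_pos g with rfl | hg
          · obtain rfl : m = 2 := by omega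
            rw [hT.init_03, hT'.init_03]
          · obtain rfl : g = 1 := by omega
            obtain rfl : m = 0 := by omega
            rw [hT.init_11, hT'.init_11]
  funext g n idx
  exact key _ g n (Nat.lt_succ_self _) idx

end Recursion

end HbarDiff

theorem theorem2p4p2 (k : Type*) [Field k] [CharZero k] (d : ℕ) :
    (∀ H : Fin d → DOp k d,
      (∀ i, ∃ P ∈ DOp.degGE 2, H i = -DOp.p i + P) →
      (∀ i j, i ≠ j → ∃ g : Fin d → DOp k d,
        H i * H j - H j * H i = hbarF k d • ∑ l, g l * H l) →
      ∃! S : ℕ → MvPowerSeries (Fin d) k, IsNormalized S ∧ IsWKBSolution H S) ∧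
    (∀ Q : QuantumAiry k d,
      ∃ S : ℕ → MvPowerSeries (Fin d) k,
        (IsNormalized S ∧ IsWKBSolution Q.H S) ∧
        (∀ S', IsNormalized S' ∧ IsWKBSolution Q.H S' → S' = S) ∧
        (∀ (en : Enumeration) (T : ∀ (_ n : ℕ), (Fin n → Fin d) → k),
          IsATR Q en T ↔ T = fun g _ idx => taylor (S g) idx) ∧
        (∀ (g n : ℕ) (σ : Equiv.Perm (Fin n)) (idx : Fin n → Fin d),
          taylor (S g) (idx ∘ σ) = taylor (S g) idx)) := by
  refine ⟨fun H hH hcomm => existsUnique_isWKBSolution H hH hcomm, fun Q => ?_⟩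
  obtain ⟨S, hS, huniq⟩ := existsUnique_isWKBSolution Q.H (airyH_eq Q.a Q.b Q.c Q.ε)
    fun i j _ => by
      obtain ⟨g, hg⟩ := Q.closed i j
      -- The structure constants serve as constant operators `g_{ij}^l`.
      refine ⟨fun l => DOp.ofFun (MvPowerSeries.C (g l)), ?_⟩
      simp only [ofFun_mul]
      exact hg
  refine ⟨S, hS, huniq, fun en T => ⟨fun hT => ?_, ?_⟩, fun g n σ idx => taylor_comp_perm _ σ idx⟩
  · exact hT.unique (isATR_taylor Q hS.1 hS.2 en)
  · rintro rfl
    exact isATR_taylor Q hS.1 hS.2 en
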